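/- **Conventions.** Let $R$ be a commutative unital ring and $\mathbb{B}=\{e\in R: e^2=e\}$ its Boolean algebra of idempotents ($e\wedge f=ef$, $\neg e=1-e$, $e\vee f=e+f-ef$, so $e\le f\Leftrightarrow ef=e$). Let $\mathcal{F}in\subseteq\mathbb{B}$ be the ideal of finite joins of atoms. For $e\in\mathbb{B}$ let $R_e$ be the localization of $R$ at $\{e^n:n\ge 0\}$ (the stalk at $e$), and let $f_e$ be the image of $f\in R$ in $R_e$. For a formula $\Theta(x_1,\dots,x_n)$ of the language of rings and $f_1,\dots,f_n\in R$ let $$[[\Theta(f_1,\dots,f_n)]]=\bigvee\{e : e \text{ an atom of } \mathbb{B},\ R_e\models\Theta((f_1)_e,\dots,(f_n)_e)\},$$ if this supremum exists in $\mathbb{B}$. Let $\mathcal{L}^{fin}_{Boolean}$ be the language $\{\vee,\wedge,\neg,0,1\}$ of Boolean algebras with additional unary predicates $Fin$ and $C_j$ ($j\ge 1$). In $(\mathbb{B},\mathcal{F}in)$, $Fin(x)$ means $x\in\mathcal{F}in$ and $C_j(x)$ means that there are at least $j$ atoms below $x$. $T^{fin}$ is the theory stating that the Boolean algebra is infinite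 and atomic, that $C_j$ has this meaning, that $Fin$ is a proper ideal containing every $x$ with at most $n$ atoms below it ($n<\omega$), and that for every $x\notin Fin$ there is $y<x$ with $y\notin Fin$ and $x\wedge\neg y\notin Fin$. Let $\varphi(w)$ be a formula of the language of rings in one free variable. The ring $R$ satisfies the axioms $\mathcal{A}_\varphi$ if 1. $\mathbb{B}$ is atomic; 2. $[[\Theta(f_1,\dots,f_n)]]$ exists for all ring formulas $\Theta$ and all $f_1,\dots,f_n\in R$; 3. for every atomic ring formula $\Theta$ and all $f_1,\dots,f_n\in R$, $R\models\Theta(f_1,\dots,f_n)$ if and only if $[[\Theta(f_1,\dots,f_n)]]=1$; 4. $(\mathbb{B},\mathcal{F}in)\models T^{fin}$, and for all ring formulas $\Theta(x_1,\dots,x_n,w)$ and all $f=(f_1,\dots,f_n)\in R^n$ there is $g\in R$ such that if $[[\exists w\,\Theta(f,w)]]\wedge\neg[[\exists w(\varphi(w)\wedge\Theta(f,w))]]\in\mathcal{F}in$, then $[[\exists w\,\Theta(f,w)]]\wedge\neg[[\Theta(f,g)]]\in\mathcal{F}in$; 5. $[[\neg\varphi(x)]]\in\mathcal{F}in$ for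 all $x\in R$. **Theorem.** (1) There is an algorithm which, given a ring formula $\varphi(w)$ in one free variable and a ring formula $\Theta(x_1,\dots,x_m)$, produces finitely many ring formulas $\Theta_1(x_1,\dots,x_m),\dots,\Theta_k(x_1,\dots,x_m)$ and an $\mathcal{L}^{fin}_{Boolean}$-formula $\psi(y_1,\dots,y_k)$ such that for every commutative unital ring $R$ satisfying $\mathcal{A}_\varphi$ and all $f_1,\dots,f_m\in R$, $$R\models\Theta(f_1,\dots,f_m)\iff(\mathbb{B},\mathcal{F}in)\models\psi\big([[\Theta_1(f_1,\dots,f_m)]],\dots,[[\Theta_k(f_1,\dots,f_m)]]\big).$$ (2) Let $\varphi(w)$ be a ring formula in one free variable and let $R$ be a commutative unital ring satisfying $\mathcal{A}_\varphi$. Then the restricted product $$\prod^{(\varphi)}_{e\text{ atom of }\mathbb{B}}R_e=\Big\{a\in\prod_{e}R_e:\ R_e\models\varphi(a_e)\text{ for all but finitely many } e\Big\}$$ is a subring of $\prod_e R_e$, and $R$ is elementarily equivalent to it in the language of rings. -/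

import Mathlib

universe u

open scoped FirstOrder

namespace RingFV

open FirstOrder FirstOrder.Language

/-! ### The enriched language of Boolean algebras -/

/-- Function symbols of the language of Boolean algebras: `∨`, `∧`, `¬`, `0`, `1`. -/
inductive BoolFunc : ℕ → Type
  | sup : BoolFunc 2
  | inf : BoolFunc 2
  | compl : BoolFunc 1
  | bot : BoolFunc 0
  | top : BoolFunc 0

/-- Predicate symbols of the enrichment: the unary predicate `Fin`, and for every `j` the
unary predicate `C_{j+1}` (so that the family of the `C_i`, `i ≥ 1`, is indexed by `ℕ`). -/
inductive BoolRel : ℕ → Type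
  | fin : BoolRel 1
  | C (j : ℕ) : BoolRel 1

/-- The language of Boolean algebras enriched by `Fin` and all the `C_i`, `i ≥ 1`. -/
def boolFin : FirstOrder.Language.{0, 0} := ⟨BoolFunc, BoolRel⟩

/-- The structure `(B, F)`: a Boolean algebra `B` in which `Fin` is interpreted by the set `F` and
`C_i x` means that there are at least `i` distinct atoms below `x`. -/
@[reducible]
def boolFinStructure (B : Type u) [BooleanAlgebra B] (F : Set B) : boolFin.Structure B where
  funMap {n} (s : BoolFunc n) := match n, s with
    | _, .sup => fun x => x 0 ⊔ x 1
    | _, .inf => fun x => x 0 ⊓ x 1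
    | _, .compl => fun x => (x 0)ᶜ
    | _, .bot => fun _ => ⊥
    | _, .top => fun _ => ⊤
  RelMap {n} (s : BoolRel n) := match n, s with
    | _, .fin => fun x => x 0 ∈ F
    | _, .C j => fun x => ∃ s : Finset B, s.card = j + 1 ∧ ∀ a ∈ s, IsAtom a ∧ a ≤ x 0

/-- `(B, F) ⊨ ψ(y)`. -/
def BoolSat {B : Type u} [BooleanAlgebra B] (F : Set B) {α : Type*}
    (ψ : boolFin.Formula α) (y : α → B) : Prop :=
  @Formula.Realize boolFin B (boolFinStructure B F) α ψ y

/-- `(B, F)` is a model of the theory `T^fin`: `B` is an infinite atomic Boolean algebra, `F` is a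
proper ideal of `B` which contains every element with only finitely many atoms below it, and
every element outside `F` splits into two elements outside `F`. -/
structure IsModelTfin (B : Type u) [BooleanAlgebra B] (F : Set B) : Prop where
  infinite : Infinite B
  exists_atom : ∀ x : B, x ≠ ⊥ → ∃ a : B, IsAtom a ∧ a ≤ x
  bot_mem : ⊥ ∈ F
  sup_mem : ∀ x ∈ F, ∀ y ∈ F, x ⊔ y ∈ F
  mem_of_le : ∀ x y : B, x ≤ y → y ∈ F → x ∈ F
  top_notMem : ⊤ ∉ F
  split : ∀ x ∉ F, ∃ y : B, y < x ∧ y ∉ F ∧ x ⊓ yᶜ ∉ F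
  mem_of_finite : ∀ x : B, {a : B | IsAtom a ∧ a ≤ x}.Finite → x ∈ F

/-! ### Rings, idempotents and stalks -/

/-- `A ⊨ Θ(v)` for a ring `A` and a formula `Θ` of the language of rings. -/
def RingSat {A : Type u} [CommRing A] {α : Type*}
    (Θ : FirstOrder.Language.ring.Formula α) (v : α → A) : Prop :=
  @Formula.Realize FirstOrder.Language.ring A (Ring.compatibleRingOfRing A).toStructure α Θ v

/-- Elementary equivalence of rings in the language of rings. -/
def RingElemEquiv (A : Type u) [CommRing A] (A' : Type u) [CommRing A'] : Prop :=
  @ElementarilyEquivalent FirstOrder.Language.ring A A'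
    (Ring.compatibleRingOfRing A).toStructure (Ring.compatibleRingOfRing A').toStructure

/-- The Boolean algebra of idempotents of `R`, where `e ∧ f = e f`, `¬ e = 1 - e`,
`e ∨ f = e + f - e f`, and `e ≤ f` means `e f = e`. -/
abbrev Idem (R : Type u) [CommRing R] : Type u := {e : R // IsIdempotentElem e}

/-- The atoms of the Boolean algebra of idempotents. -/
abbrev Atoms (R : Type u) [CommRing R] : Type u := {e : Idem R // IsAtom e}

variable {R : Type u} [CommRing R]

/-- The stalk `R_e`: the localization of `R` at the powers of `e`. -/
abbrev Stalk (e : Idem R) : Type u := Localization.Away (e : R)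

/-- The idempotents of finite support: the finite joins of atoms. -/
def finSupp (R : Type u) [CommRing R] : Set (Idem R) :=
  {x | ∃ s : Finset (Idem R), (∀ e ∈ s, IsAtom e) ∧ x = s.sup id}

/-- The set of atoms `e` with `R_e ⊨ Θ(f_e)`, where `f_e` is the image of `f` in `R_e`. -/
def satAtoms {α : Type*} (Θ : FirstOrder.Language.ring.Formula α) (f : α → R) : Set (Idem R) :=
  {e | IsAtom e ∧ RingSat Θ (fun i => algebraMap R (Stalk e) (f i))}

open Classical in
/-- The Boolean value `[[Θ(f)]]`: the supremum, in the Boolean algebra of idempotents, of the set of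
atoms `e` with `R_e ⊨ Θ(f_e)`. (It has the value `0` if there is no such supremum.) -/
noncomputable def boolVal {α : Type*} (Θ : FirstOrder.Language.ring.Formula α) (f : α → R) : Idem R :=
  if h : ∃ x : Idem R, IsLUB (satAtoms Θ f) x then h.choose else ⊥

/-- The ring `R` satisfies the axioms `A_φ`. -/
structure SatisfiesAxioms (φ : FirstOrder.Language.ring.Formula (Fin 1)) (R : Type u) [CommRing R] :
    Prop where
  /-- The Boolean algebra of idempotents is atomic. -/
  exists_atom : ∀ x : Idem R, x ≠ ⊥ → ∃ a : Idem R, IsAtom a ∧ a ≤ x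
  /-- All Boolean values exist. -/
  exists_boolVal : ∀ (n : ℕ) (Θ : FirstOrder.Language.ring.Formula (Fin n)) (f : Fin n → R),
    ∃ x : Idem R, IsLUB (satAtoms Θ f) x
  /-- An atomic formula holds in `R` if and only if its Boolean value is `1`. -/
  atomic_iff : ∀ (n : ℕ) (Θ : FirstOrder.Language.ring.Formula (Fin n)), BoundedFormula.IsAtomic Θ →
    ∀ f : Fin n → R, RingSat Θ f ↔ boolVal Θ f = ⊤
  /-- The idempotents, with the ideal of those of finite support, form a model of `T^fin`. -/
  modelTfin : IsModelTfin (Idem R) (finSupp R)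
  /-- For a formula `Θ(x_1, …, x_n, w)` (with `w` the variable `Sum.inr 0`) and `f` in `R` there is
  `g` in `R` such that, if `[[∃ w Θ(f, w)]] ∧ ¬ [[∃ w (φ(w) ∧ Θ(f, w))]]` has finite support,
  then `[[∃ w Θ(f, w)]] ∧ ¬ [[Θ(f, g)]]` has finite support. -/
  exists_witness : ∀ (n : ℕ) (Θ : FirstOrder.Language.ring.Formula (Fin n ⊕ Fin 1)) (f : Fin n → R),
    ∃ g : R,
      boolVal (Formula.iExs (Fin 1) Θ) f ⊓
          (boolVal (Formula.iExs (Fin 1) (φ.relabel Sum.inr ⊓ Θ)) f)ᶜ ∈ finSupp R →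
        boolVal (Formula.iExs (Fin 1) Θ) f ⊓
          (boolVal Θ (Sum.elim f (fun _ => g)))ᶜ ∈ finSupp R
  /-- Every element of `R` satisfies `φ` at all but finitely many atoms. -/
  not_mem_finSupp : ∀ x : R, boolVal φ.not (fun _ => x) ∈ finSupp R

/-! ### Gödel numbers of formulas -/

/-- Gödel numbers of terms in the variables `x_i`, `i < m`, and `z_j`, `j < n`, relative to a
numbering `cf` of the function symbols. -/
def termCode {L : FirstOrder.Language.{0, 0}} (cf : ∀ l, L.Functions l → ℕ) {m n : ℕ} :
    L.Term (Fin m ⊕ Fin n) → ℕ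
  | .var (.inl i) => Nat.pair 0 i + 1
  | .var (.inr j) => Nat.pair 1 j + 1
  | .func (l := l) s ts =>
      Nat.pair 2 (Nat.pair (cf l s) (Encodable.encode (List.ofFn fun i => termCode cf (ts i)))) + 1

/-- Gödel numbers of formulas, relative to numberings `cf` of the function symbols and `cr` of the
relation symbols. -/
def formulaCode {L : FirstOrder.Language.{0, 0}} (cf : ∀ l, L.Functions l → ℕ) (cr : ∀ l, L.Relations l → ℕ)
    {m : ℕ} : ∀ {n : ℕ}, L.BoundedFormula (Fin m) n → ℕ
  | _, .falsum => 0
  | _, .equal t₁ t₂ => Nat.pair 0 (Nat.pair (termCode cf t₁) (termCode cf t₂)) + 1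
  | _, .rel (l := l) s ts =>
      Nat.pair 1 (Nat.pair (cr l s) (Encodable.encode (List.ofFn fun i => termCode cf (ts i)))) + 1
  | _, .imp φ ψ => Nat.pair 2 (Nat.pair (formulaCode cf cr φ) (formulaCode cf cr ψ)) + 1
  | _, .all φ => Nat.pair 3 (formulaCode cf cr φ) + 1

/-- Numbering of the function symbols of the language of rings. -/
def ringFuncCode (l : ℕ) (s : ringFunc l) : ℕ := match l, s with
  | _, .add => 0
  | _, .mul => 1
  | _, .neg => 2
  | _, .zero => 3
  | _, .one => 4

/-- Numbering of the function symbols of `boolFin`. -/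
def boolFuncCode (l : ℕ) (s : BoolFunc l) : ℕ := match l, s with
  | _, .sup => 0
  | _, .inf => 1
  | _, .compl => 2
  | _, .bot => 3
  | _, .top => 4

/-- Numbering of the relation symbols of `boolFin`. -/
def boolRelCode (l : ℕ) (s : BoolRel l) : ℕ := match l, s with
  | _, .fin => 0
  | _, .C j => j + 1

/-- The Gödel number of a ring formula in the free variables `x_i`, `i < m`. -/
def ringCode {m : ℕ} (Θ : FirstOrder.Language.ring.Formula (Fin m)) : ℕ :=
  formulaCode (L := FirstOrder.Language.ring) ringFuncCode (fun _ s => Empty.elim s) Θ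

/-- The Gödel number of a `boolFin`-formula in the free variables `y_i`, `i < k`. -/
def boolCode {k : ℕ} (ψ : boolFin.Formula (Fin k)) : ℕ :=
  formulaCode (L := boolFin) boolFuncCode boolRelCode ψ

end RingFV

open scoped FirstOrder

namespace RingFV

open FirstOrder FirstOrder.Language

attribute [local instance] Ring.compatibleRingOfRing

/-! Both parts are of Feferman–Vaught type. By the axioms, `R` embeds into the product of its stalks
at atoms, Boolean values are sets of atoms, and two sources of elements are available: idempotents
prescribe values in finitely many stalks, and axiom 4 yields a global witness for a formula
satisfiable in every stalk, provided that the witness can be taken in `φ` in almost every stalk.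
`StalkFrame` isolates these properties. The ring `R` satisfies them with the algebra of sets of
atoms below an idempotent (`SatisfiesAxioms.stalkFrame`), and the restricted product satisfies them
with all sets of atoms (`StalkFrame.restrictedProduct_stalkFrame`).

The heart of both parts is the treatment of a quantifier `∃ w` over the ring. Let `θ_1, …, θ_k` be
the formulas whose Boolean values decide the scope. A partition of the atoms into `2 ^ k` cells is
the partition into truth patterns of the `θ_i` at some ring element `w` if and only if each cell
lies in the set of atoms where its pattern is realised, and all but finitely many of its atoms lie
in the set where the pattern is realised inside `φ`. Necessity holds because an element of the ring
satisfies `φ` at almost all atoms; sufficiency is `StalkFrame.exists_forall_realize_iff`.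

For part 2, restricted families are closed under the ring operations: a failure at infinitely many
atoms could be copied by elements of `R`, against axiom 5 (`StalkFrame.finite_not_term`). For
elementary equivalence, `exists_typeAt_determines` shows that truth in a frame depends only on the
sizes of the sets of indices of each type, where a size counts up to a finite threshold and as
finite or infinite. The quantifier step is a back-and-forth argument (`StalkFrame.exists_matching`)
resting on the splitting of infinite sets (`exists_refinement`). For a sentence the types in the two
frames coincide atom by atom.

For part 1, the cell conditions are written with equality and `Fin`, so `∀ w` becomes a block of `k`
quantifiers over idempotents (`SatisfiesAxioms.forall_block_iff`). The resulting recursion is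
carried out on Gödel numbers (`trans`); it is computable by the recursion theorem
(`computable_treeRec`) and correct by induction on the formula (`exists_translatesTo`). -/

/-- An algebra of subsets of `X` which contains all finite sets and in which every infinite set
is a disjoint union of two infinite sets. -/
structure SplittingAlgebra {X : Type*} (𝓑 : Set (Set X)) : Prop where
  compl_mem : ∀ Y ∈ 𝓑, Yᶜ ∈ 𝓑
  inter_mem : ∀ Y ∈ 𝓑, ∀ Z ∈ 𝓑, Y ∩ Z ∈ 𝓑
  mem_of_finite : ∀ Y : Set X, Y.Finite → Y ∈ 𝓑
  split : ∀ Y ∈ 𝓑, Y.Infinite → ∃ Z ∈ 𝓑, Z ⊆ Y ∧ Z.Infinite ∧ (Y \ Z).Infinite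

/-! ### Frames: rings that behave like restricted products. -/

section Frame

/-- A ring `A` with homomorphisms to the rings `S x`, and an algebra `𝓑` of subsets of the index
set, which behaves like a restricted product of the `S x` with respect to `φ`. -/
structure StalkFrame (φ : Language.ring.Formula (Fin 1)) {X : Type u} (S : X → Type u)
    [∀ x, CommRing (S x)] {A : Type u} [CommRing A] (π : ∀ x, A →+* S x) (𝓑 : Set (Set X)) :
    Prop extends SplittingAlgebra 𝓑 where
  nontrivial : ∀ x, Nontrivial (S x)
  eq_zero : ∀ a, (∀ x, π x a = 0) → a = 0
  exists_indicator : ∀ Y ∈ 𝓑, ∃ e, ∀ x, (x ∈ Y → π x e = 1) ∧ (x ∉ Y → π x e = 0)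
  finite_not : ∀ a, {x | ¬ φ.Realize (fun _ => π x a)}.Finite
  sat_mem : ∀ (n : ℕ) (Θ : Language.ring.Formula (Fin n)) (f : Fin n → A),
    {x | Θ.Realize (fun i => π x (f i))} ∈ 𝓑
  glue : ∀ (n : ℕ) (Θ : Language.ring.Formula (Fin n ⊕ Fin 1)) (f : Fin n → A),
    (∀ x, ∃ w : S x, Θ.Realize (Sum.elim (fun i => π x (f i)) fun _ => w)) →
    {x | ¬ ∃ w : S x, φ.Realize (fun _ => w) ∧
      Θ.Realize (Sum.elim (fun i => π x (f i)) fun _ => w)}.Finite →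
    ∃ g, ∀ x, Θ.Realize (Sum.elim (fun i => π x (f i)) fun _ => π x g)

/-- A ring homomorphism is a homomorphism of structures. -/
def ringHomToLanguageHom {A B : Type*} [CommRing A] [CommRing B] (f : A →+* B) :
    Language.ring.Hom A B where
  toFun := f
  map_fun' := fun {n} s => by cases s <;> simp
  map_rel' := fun {n} s => by cases s

theorem realize_term_map {A B : Type*} [CommRing A] [CommRing B] (f : A →+* B) {α : Type*}
    (t : Language.ring.Term α) (v : α → A) : t.realize (f ∘ v) = f (t.realize v) :=
  HomClass.realize_term (ringHomToLanguageHom f)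

variable {φ : Language.ring.Formula (Fin 1)} {X : Type u} {S : X → Type u}
  [∀ x, CommRing (S x)] {A : Type u} [CommRing A] {π : ∀ x, A →+* S x} {𝓑 : Set (Set X)}

/-- `A` embeds into the product of the `S x`, by `eq_zero` applied to the difference. -/
theorem StalkFrame.realize_equal_iff (h : StalkFrame φ S π 𝓑) {α : Type*}
    (t₁ t₂ : Language.ring.Term α) (v : α → A) :
    t₁.realize v = t₂.realize v ↔ ∀ x, t₁.realize (π x ∘ v) = t₂.realize (π x ∘ v) := by
  simp only [realize_term_map]
  refine ⟨fun e x => by rw [e], fun e => sub_eq_zero.1 (h.eq_zero _ fun x => ?_)⟩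
  rw [map_sub, e x, sub_self]

theorem StalkFrame.setOf_realize_mem (h : StalkFrame φ S π 𝓑) {α : Type*} [Finite α] {n : ℕ}
    (θ : Language.ring.BoundedFormula α n) (f : α → A) (xs : Fin n → A) :
    {x | θ.Realize (π x ∘ f) (π x ∘ xs)} ∈ 𝓑 := by
  obtain ⟨N, ⟨e⟩⟩ := Finite.exists_equiv_fin (α ⊕ Fin n)
  convert h.sat_mem N (θ.toFormula.relabel e) (Sum.elim f xs ∘ e.symm) using 3 with x
  rw [Formula.realize_relabel, BoundedFormula.realize_toFormula]
  apply iff_of_eq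
  congr 1 <;> ext i <;> simp

/-- Gluing with a prescribed truth pattern. Each `Z i` enters as an extra ring parameter, its
indicator `u i`: the stalks being nontrivial, `u i = 1` holds exactly on `Z i`. So `glue` applies to
the single formula `⋀ (θ i ↔ u i = 1)`. -/
theorem StalkFrame.exists_forall_realize_iff (h : StalkFrame φ S π 𝓑) {α : Type*} [Finite α] {n : ℕ}
    {ι : Type*} [Finite ι] (θ : ι → Language.ring.BoundedFormula α (n + 1)) (f : α → A)
    (xs : Fin n → A) (Z : ι → Set X) (hZ : ∀ i, Z i ∈ 𝓑)
    (h₁ : ∀ x, ∃ w : S x, ∀ i, (θ i).Realize (π x ∘ f) (Fin.snoc (π x ∘ xs) w) ↔ x ∈ Z i)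
    (h₂ : {x | ¬ ∃ w : S x, φ.Realize (fun _ => w) ∧
      ∀ i, (θ i).Realize (π x ∘ f) (Fin.snoc (π x ∘ xs) w) ↔ x ∈ Z i}.Finite) :
    ∃ g, ∀ x i, (θ i).Realize (π x ∘ f) (Fin.snoc (π x ∘ xs) (π x g)) ↔ x ∈ Z i := by
  obtain ⟨N, ⟨e⟩⟩ := Finite.exists_equiv_fin ((α ⊕ Fin n) ⊕ ι)
  choose u hu using fun i => h.exists_indicator (Z i) (hZ i)
  let r : α ⊕ Fin (n + 1) → Fin N ⊕ Fin 1 :=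
    Sum.elim (fun a => .inl (e (.inl (.inl a))))
      (Fin.snoc (α := fun _ => Fin N ⊕ Fin 1) (fun j => .inl (e (.inl (.inr j)))) (.inr 0))
  let Ψ : Language.ring.Formula (Fin N ⊕ Fin 1) := BoundedFormula.iInf fun i : ι =>
    ((θ i).toFormula.relabel r).iff (Term.equal (.var (.inl (e (.inr i)))) 1)
  have key : ∀ x (w : S x), Ψ.Realize
      (Sum.elim (fun i => π x ((Sum.elim (Sum.elim f xs) u ∘ e.symm) i)) fun _ => w) ↔
      ∀ i, (θ i).Realize (π x ∘ f) (Fin.snoc (π x ∘ xs) w) ↔ x ∈ Z i := by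
    intro x w
    have := h.nontrivial x
    simp only [Ψ, Formula.Realize, BoundedFormula.realize_iInf, BoundedFormula.realize_iff]
    refine forall_congr' fun i => iff_congr ?_ ?_
    · change Formula.Realize _ _ ↔ _
      rw [Formula.realize_relabel, BoundedFormula.realize_toFormula]
      apply iff_of_eq
      congr 1
      · ext a; simp [r]
      · ext j
        refine Fin.lastCases ?_ (fun j => ?_) j <;> simp [r]
    · change Formula.Realize _ _ ↔ _
      rw [Formula.realize_equal]
      simp only [Term.realize_var, Sum.elim_inl, Function.comp, Equiv.symm_apply_apply,
        Sum.elim_inr, Ring.realize_one]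
      by_cases hx : x ∈ Z i
      · simp [hx, (hu i x).1 hx]
      · simp [hx, (hu i x).2 hx]
  obtain ⟨g, hg⟩ := h.glue N Ψ (Sum.elim (Sum.elim f xs) u ∘ e.symm)
    (fun x => by simpa only [key] using h₁ x) (by simpa only [key] using h₂)
  exact ⟨g, fun x => (key x _).1 (hg x)⟩

end Frame

/-! ### Idempotents, atoms and their stalks. -/

section Idempotents

variable {R : Type u} [CommRing R]

theorem idem_le_iff {x y : Idem R} : x ≤ y ↔ (x : R) * y = x :=
  Iff.rfl

/-- The image of `e` is an idempotent unit. -/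
theorem algebraMap_stalk_self (e : Idem R) : algebraMap R (Stalk e) e = 1 := by
  have h := IsLocalization.Away.algebraMap_isUnit (S := Stalk e) (e : R)
  exact (h.mul_eq_left (b := _)).1 (by rw [← map_mul, e.2.eq])

theorem algebraMap_stalk_surjective (e : Idem R) : Function.Surjective (algebraMap R (Stalk e)) := by
  intro w
  obtain ⟨n, r, h⟩ := IsLocalization.Away.surj (e : R) w
  exact ⟨r, by rw [← h, algebraMap_stalk_self, one_pow, mul_one]⟩

theorem nontrivial_stalk {e : Idem R} (he : e ≠ ⊥) : Nontrivial (Stalk e) := by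
  refine ⟨1, 0, fun h => he (Subtype.ext ?_)⟩
  rw [← algebraMap_stalk_self e, IsLocalization.map_eq_zero_iff (Submonoid.powers (e : R))] at h
  obtain ⟨⟨_, n, rfl⟩, h⟩ := h
  have h : (e : R) ^ (n + 1) = 0 := by rw [pow_succ]; exact h
  rwa [e.2.pow_succ_eq] at h

theorem algebraMap_stalk_of_le {e y : Idem R} (h : e ≤ y) : algebraMap R (Stalk e) y = 1 := by
  have := congr_arg (algebraMap R (Stalk e)) (idem_le_iff.1 h)
  rwa [map_mul, algebraMap_stalk_self, one_mul] at this

theorem algebraMap_stalk_of_not_le {e y : Idem R} (he : IsAtom e) (h : ¬ e ≤ y) :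
    algebraMap R (Stalk e) y = 0 := by
  have := congr_arg (algebraMap R (Stalk e))
    (congr_arg Subtype.val ((he.not_le_iff_disjoint.1 h).eq_bot))
  change algebraMap R (Stalk e) (e * y) = algebraMap R (Stalk e) 0 at this
  rwa [map_mul, algebraMap_stalk_self, one_mul, map_zero] at this

/-- An atom outside `T` is disjoint from every member of `T`, so its complement is an upper bound of
`T`. -/
theorem isAtom_le_sSup_iff {B : Type*} [BooleanAlgebra B] {T : Set B} (hT : ∀ a ∈ T, IsAtom a)
    {x a : B} (hx : IsLUB T x) (ha : IsAtom a) : a ≤ x ↔ a ∈ T := by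
  refine ⟨fun h => ?_, fun h => hx.1 h⟩
  by_contra hn
  have : x ≤ aᶜ := hx.2 fun b hb => le_compl_iff_disjoint_right.2
    ((hT b hb).disjoint_of_ne ha (by rintro rfl; exact hn hb))
  exact ha.1 (le_compl_self.1 (h.trans this))

/-- The set of atoms below an idempotent. -/
def atomsBelow (x : Idem R) : Set (Atoms R) := {a | a.1 ≤ x}

@[simp]
theorem mem_atomsBelow {x : Idem R} {a : Atoms R} : a ∈ atomsBelow x ↔ a.1 ≤ x := Iff.rfl

theorem atomsBelow_compl (x : Idem R) : atomsBelow xᶜ = (atomsBelow x)ᶜ := by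
  ext a
  simp only [mem_atomsBelow, Set.mem_compl_iff, le_compl_iff_disjoint_right]
  exact ⟨fun h h' => a.2.1 (h.eq_bot_of_le h'), fun h => a.2.not_le_iff_disjoint.1 h⟩

theorem atomsBelow_inf (x y : Idem R) : atomsBelow (x ⊓ y) = atomsBelow x ∩ atomsBelow y := by
  ext a
  simp

theorem finite_atomsBelow_iff {x : Idem R} :
    (atomsBelow x).Finite ↔ {a : Idem R | IsAtom a ∧ a ≤ x}.Finite := by
  have : {a : Idem R | IsAtom a ∧ a ≤ x} = Subtype.val '' atomsBelow x := by
    ext a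
    simp [atomsBelow, and_comm]
  rw [this, Set.finite_image_iff Subtype.val_injective.injOn]

end Idempotents

/-! ### A ring satisfying the axioms is a frame over its atoms. -/

section Axioms

variable {R : Type u} [CommRing R] {φ : Language.ring.Formula (Fin 1)}

theorem SatisfiesAxioms.eq_bot_iff (h : SatisfiesAxioms φ R) {x : Idem R} :
    x = ⊥ ↔ atomsBelow x = ∅ := by
  constructor
  · rintro rfl
    ext a
    simpa using a.2.1
  · intro hx
    by_contra hn
    obtain ⟨a, ha, hax⟩ := h.exists_atom x hn
    exact Set.notMem_empty (⟨a, ha⟩ : Atoms R) (hx ▸ hax)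

theorem SatisfiesAxioms.eq_top_iff (h : SatisfiesAxioms φ R) {x : Idem R} :
    x = ⊤ ↔ ∀ a, a ∈ atomsBelow x := by
  rw [← compl_eq_bot, h.eq_bot_iff, atomsBelow_compl, Set.compl_empty_iff, Set.eq_univ_iff_forall]

theorem SatisfiesAxioms.mem_finSupp_iff (h : SatisfiesAxioms φ R) {x : Idem R} :
    x ∈ finSupp R ↔ (atomsBelow x).Finite := by
  rw [finite_atomsBelow_iff]
  refine ⟨?_, h.modelTfin.mem_of_finite x⟩
  rintro ⟨s, hs, rfl⟩
  refine s.finite_toSet.subset fun a ha => ?_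
  refine (isAtom_le_sSup_iff (T := (s : Set (Idem R))) (by simpa using hs) ?_ ha.1).1 ha.2
  simpa using s.isLUB_sup (f := id)

theorem SatisfiesAxioms.atomsBelow_boolVal_of_fin (h : SatisfiesAxioms φ R) {n : ℕ}
    (Θ : Language.ring.Formula (Fin n)) (f : Fin n → R) :
    atomsBelow (boolVal Θ f) = {a | Θ.Realize (fun i => algebraMap R (Stalk a.1) (f i))} := by
  have hx := h.exists_boolVal n Θ f
  have := hx.choose_spec
  rw [boolVal, dif_pos hx]
  ext a
  rw [mem_atomsBelow, isAtom_le_sSup_iff (fun b hb => hb.1) this a.2]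
  exact ⟨fun h => h.2, fun h => ⟨a.2, h⟩⟩

theorem satAtoms_relabel {α β : Type*} (e : α ≃ β) (Θ : Language.ring.Formula α) (f : β → R) :
    satAtoms (Θ.relabel e) f = satAtoms Θ (f ∘ e) := by
  ext a
  simp only [satAtoms, RingSat, Set.mem_ofPred_eq, Formula.realize_relabel]
  rfl

/-- The axioms provide suprema only for variables indexed by `Fin n`; a bijective relabelling leaves
`satAtoms` unchanged. -/
theorem SatisfiesAxioms.atomsBelow_boolVal (h : SatisfiesAxioms φ R) {α : Type*} [Finite α]
    (Θ : Language.ring.Formula α) (f : α → R) :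
    atomsBelow (boolVal Θ f) = {a | Θ.Realize (fun i => algebraMap R (Stalk a.1) (f i))} := by
  obtain ⟨N, ⟨e⟩⟩ := Finite.exists_equiv_fin α
  have : boolVal Θ f = boolVal (Θ.relabel e) (f ∘ e.symm) := by
    have : satAtoms (Θ.relabel e) (f ∘ e.symm) = satAtoms Θ f := by
      rw [satAtoms_relabel, Function.comp_assoc, Equiv.symm_comp_self, Function.comp_id]
    rw [boolVal, boolVal, this]
  rw [this, h.atomsBelow_boolVal_of_fin]
  ext a
  simp only [Set.mem_ofPred_eq, Formula.realize_relabel]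
  apply iff_of_eq
  congr 1
  ext i
  simp

/-- An element with prescribed images in finitely many stalks at atoms, and equal to a given one
at all other atoms. -/
theorem exists_eq_on_finset (g : R) (w : ∀ a : Atoms R, Stalk a.1) {T : Set (Atoms R)}
    (hT : T.Finite) : ∃ g' : R, ∀ a : Atoms R,
      (a ∈ T → algebraMap R (Stalk a.1) g' = w a) ∧
      (a ∉ T → algebraMap R (Stalk a.1) g' = algebraMap R (Stalk a.1) g) := by
  induction T, hT using Set.Finite.induction_on with
  | empty => exact ⟨g, by simp⟩
  | @insert b T hb _ ih =>
    obtain ⟨g', hg'⟩ := ih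
    obtain ⟨r, hr⟩ := algebraMap_stalk_surjective b.1 (w b)
    -- The idempotent `b` is 1 in its own stalk and 0 in the stalk at any other atom.
    refine ⟨g' * (1 - b.1) + r * b.1, fun a => ?_⟩
    by_cases hab : a = b
    · subst hab
      simp [algebraMap_stalk_self, hr]
    · have h0 : algebraMap R (Stalk a.1) b.1 = 0 := algebraMap_stalk_of_not_le a.2 fun hle =>
        hab (Subtype.ext ((b.2.le_iff_eq a.2.1).1 hle))
      simpa [h0, hab] using hg' a

/-- Only `glue` needs an argument beyond translating the axioms: axiom 4 gives a witness off a
finite set of atoms, and `exists_eq_on_finset` repairs it on that set. -/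
theorem SatisfiesAxioms.stalkFrame (h : SatisfiesAxioms φ R) :
    StalkFrame φ (fun a : Atoms R => Stalk a.1) (fun a => algebraMap R (Stalk a.1))
      (Set.range atomsBelow) where
  nontrivial a := nontrivial_stalk a.2.1
  eq_zero r hr := by
    let Θ : Language.ring.Formula (Fin 1) := Term.equal (.var 0) 0
    have h1 := h.atomic_iff 1 Θ (BoundedFormula.IsAtomic.equal _ _) (fun _ => r)
    have h2 : boolVal Θ (fun _ => r) = ⊤ := by
      rw [h.eq_top_iff, h.atomsBelow_boolVal]
      intro a
      simp only [Θ, Set.mem_ofPred_eq, Formula.realize_equal, Term.realize_var, Ring.realize_zero]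
      exact hr a
    have h3 : Θ.Realize (fun _ => r) := h1.2 h2
    simpa [Θ, Formula.realize_equal] using h3
  compl_mem := by
    rintro _ ⟨x, rfl⟩
    exact ⟨xᶜ, atomsBelow_compl x⟩
  inter_mem := by
    rintro _ ⟨x, rfl⟩ _ ⟨y, rfl⟩
    exact ⟨x ⊓ y, atomsBelow_inf x y⟩
  mem_of_finite Y hY := by
    refine ⟨hY.toFinset.sup Subtype.val, ?_⟩
    ext a
    rw [mem_atomsBelow, isAtom_le_sSup_iff (T := Subtype.val '' Y) ?_ ?_ a.2]
    · simpa using fun _ => a.2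
    · rintro _ ⟨b, -, rfl⟩
      exact b.2
    · simpa using hY.toFinset.isLUB_sup (f := Subtype.val)
  split := by
    rintro _ ⟨x, rfl⟩ hx
    obtain ⟨y, hyx, hy, hxy⟩ := h.modelTfin.split x (by rwa [h.mem_finSupp_iff])
    rw [h.mem_finSupp_iff] at hy hxy
    rw [atomsBelow_inf, atomsBelow_compl] at hxy
    exact ⟨_, ⟨y, rfl⟩, fun a ha => le_trans ha hyx.le, hy, hxy⟩
  exists_indicator := by
    rintro _ ⟨x, rfl⟩
    exact ⟨x.1, fun a => ⟨algebraMap_stalk_of_le, algebraMap_stalk_of_not_le a.2⟩⟩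
  finite_not r := by
    have := h.mem_finSupp_iff.1 (h.not_mem_finSupp r)
    rw [h.atomsBelow_boolVal] at this
    simpa only [Formula.realize_not] using this
  sat_mem n Θ f := ⟨_, h.atomsBelow_boolVal Θ f⟩
  glue n Θ f h₁ h₂ := by
    obtain ⟨g, hg⟩ := h.exists_witness n Θ f
    simp only [h.mem_finSupp_iff, atomsBelow_inf, atomsBelow_compl, h.atomsBelow_boolVal] at hg
    have e₁ : ∀ a : Atoms R, (Formula.iExs (Fin 1) Θ).Realize
        (fun i => algebraMap R (Stalk a.1) (f i)) := fun a =>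
      Formula.realize_iExs.2 ((h₁ a).imp' (fun w _ => w) fun _ hw => hw)
    have e₂ : ∀ a : Atoms R, (Formula.iExs (Fin 1) (φ.relabel Sum.inr ⊓ Θ)).Realize
        (fun i => algebraMap R (Stalk a.1) (f i)) ↔ ∃ w : Stalk a.1, φ.Realize (fun _ => w) ∧
          Θ.Realize (Sum.elim (fun i => algebraMap R (Stalk a.1) (f i)) fun _ => w) := by
      intro a
      rw [Formula.realize_iExs]
      constructor
      · rintro ⟨w, hw⟩
        rw [Formula.realize_inf, Formula.realize_relabel] at hw
        have hw' : (fun _ => w 0) = w := funext fun i => by rw [Subsingleton.elim i 0]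
        exact ⟨w 0, by rw [hw']; exact hw⟩
      · rintro ⟨w, hw⟩
        refine ⟨fun _ => w, ?_⟩
        rw [Formula.realize_inf, Formula.realize_relabel]
        exact hw
    have := hg (h₂.subset fun a ha => fun hn => ha.2 ((e₂ a).2 hn))
    choose w hw using h₁
    -- `this` says that `Θ(f, g)` fails at only finitely many atoms; there `g` is overwritten by the
    -- local witnesses `w`.
    obtain ⟨g', hg'⟩ := exists_eq_on_finset g w this
    refine ⟨g', fun a => ?_⟩
    by_cases ha : a ∈ {a : Atoms R | Θ.Realize
      (Sum.elim (fun i => algebraMap R (Stalk a.1) (f i)) fun _ => algebraMap R (Stalk a.1) g)}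
    · rw [(hg' a).2 (fun hn => hn.2 (by
        refine (iff_of_eq ?_).1 ha
        simp only [Set.mem_ofPred_eq]
        congr 1
        ext i; rcases i with i | i <;> rfl))]
      exact ha
    · rw [(hg' a).1 ⟨e₁ a, fun hn => ha (by
        refine (iff_of_eq ?_).1 hn
        simp only [Set.mem_ofPred_eq]
        congr 1
        ext i; rcases i with i | i <;> rfl)⟩]
      exact hw a

end Axioms

/-! ### The restricted product is a subring and again a frame. -/

section RestrictedProduct

variable {φ : Language.ring.Formula (Fin 1)} {X : Type u} {S : X → Type u}
  [∀ x, CommRing (S x)] {A : Type u} [CommRing A] {π : ∀ x, A →+* S x} {𝓑 : Set (Set X)}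

theorem StalkFrame.finite_not_exists (h : StalkFrame φ S π 𝓑) :
    {x | ¬ ∃ w : S x, φ.Realize fun _ => w}.Finite :=
  (h.finite_not 0).subset fun _ hx hw => hx ⟨_, hw⟩

/-- Families of pairs which satisfy `φ` and a given formula wherever possible come from the ring. -/
theorem StalkFrame.exists_pair (h : StalkFrame φ S π 𝓑) (β : Language.ring.Formula (Fin 2))
    (hβ : ∀ x (v : Fin 2 → S x), β.Realize v → ∀ i, φ.Realize fun _ => v i) :
    ∃ g g' : A, ∀ x, (∃ v : Fin 2 → S x, β.Realize v) → β.Realize ![π x g, π x g'] := by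
  -- The pair is chosen one coordinate at a time. Both formulas are implications, hence satisfiable
  -- at every index as `glue` requires. Where `β` is satisfiable the witness lies in `φ` by `hβ`;
  -- elsewhere any element of `φ` serves.
  let Θ : Language.ring.Formula (Fin 0 ⊕ Fin 1) :=
    (Formula.iExs (Fin 2) (β.relabel Sum.inr)).imp
      (Formula.iExs (Fin 1) (β.relabel ![Sum.inl (Sum.inr 0), Sum.inr 0]))
  let Θ' : Language.ring.Formula (Fin 1 ⊕ Fin 1) :=
    (Formula.iExs (Fin 1) (β.relabel ![Sum.inl (Sum.inl 0), Sum.inr 0])).imp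
      (β.relabel ![Sum.inl 0, Sum.inr 0])
  have hΘ : ∀ x (p : Fin 0 → S x) w, Θ.Realize (Sum.elim p fun _ => w) ↔
      ((∃ v : Fin 2 → S x, β.Realize v) → ∃ w', β.Realize ![w, w']) := by
    intro x p w
    simp only [Θ, Formula.realize_imp, Formula.realize_iExs, Formula.realize_relabel]
    refine imp_congr Iff.rfl ⟨fun ⟨i, hi⟩ => ⟨i 0, ?_⟩, fun ⟨w', hw⟩ => ⟨fun _ => w', ?_⟩⟩
    · convert hi using 1
      ext j; fin_cases j <;> simp
    · convert hw using 1
      ext j; fin_cases j <;> simp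
  have hΘ' : ∀ x (p : S x) w, Θ'.Realize (Sum.elim (fun _ => p) fun _ => w) ↔
      ((∃ w', β.Realize ![p, w']) → β.Realize ![p, w]) := by
    intro x p w
    simp only [Θ', Formula.realize_imp, Formula.realize_iExs, Formula.realize_relabel]
    refine imp_congr ⟨fun ⟨i, hi⟩ => ⟨i 0, ?_⟩, fun ⟨w', hw⟩ => ⟨fun _ => w', ?_⟩⟩ (iff_of_eq ?_)
    · convert hi using 1
      ext j; fin_cases j <;> simp
    · convert hw using 1
      ext j; fin_cases j <;> simp
    · congr 1
      ext j; fin_cases j <;> simp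
  have cons : ∀ x (v : Fin 2 → S x), ![v 0, v 1] = v := fun x v => by
    ext j; fin_cases j <;> rfl
  obtain ⟨g, hg⟩ := h.glue 0 Θ Fin.elim0
    (fun x => by
      simp only [hΘ]
      by_cases hx : ∃ v : Fin 2 → S x, β.Realize v
      · obtain ⟨v, hv⟩ := hx
        exact ⟨v 0, fun _ => ⟨v 1, by rwa [cons]⟩⟩
      · exact ⟨0, fun hv => absurd hv hx⟩)
    (h.finite_not_exists.subset fun x hx ⟨w, hw⟩ => hx (by
      simp only [hΘ]
      by_cases hx : ∃ v : Fin 2 → S x, β.Realize v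
      · obtain ⟨v, hv⟩ := hx
        exact ⟨v 0, hβ x v hv 0, fun _ => ⟨v 1, by rwa [cons]⟩⟩
      · exact ⟨w, hw, fun hv => absurd hv hx⟩))
  obtain ⟨g', hg'⟩ := h.glue 1 Θ' (fun _ => g)
    (fun x => by
      simp only [hΘ']
      by_cases hx : ∃ w, β.Realize ![π x g, w]
      · exact hx.imp fun w hw _ => hw
      · exact ⟨0, fun hv => absurd hv hx⟩)
    (h.finite_not_exists.subset fun x hx ⟨w, hw⟩ => hx (by
      simp only [hΘ']
      by_cases hx : ∃ w, β.Realize ![π x g, w]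
      · exact hx.imp fun w hw => ⟨hβ x _ hw 1, fun _ => hw⟩
      · exact ⟨w, hw, fun hv => absurd hv hx⟩))
  simp only [hΘ, hΘ'] at hg hg'
  exact ⟨g, g', fun x hx => hg' x (hg x hx)⟩

/-- Let `β(v)` say that both coordinates satisfy `φ` but `t(v)` does not. By `exists_pair` some `g,
g'` in `A` satisfy `β` wherever it is satisfiable. Since `t(g, g')` is in `A`, it violates `φ` only
finitely often, so `β` is satisfiable at only finitely many indices. -/
theorem StalkFrame.finite_not_term (h : StalkFrame φ S π 𝓑) (t : Language.ring.Term (Fin 2))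
    {a b : ∀ x, S x} (ha : {x | ¬ φ.Realize fun _ => a x}.Finite)
    (hb : {x | ¬ φ.Realize fun _ => b x}.Finite) :
    {x | ¬ φ.Realize fun _ => t.realize ![a x, b x]}.Finite := by
  let β : Language.ring.Formula (Fin 2) :=
    φ.relabel (fun _ => 0) ⊓ φ.relabel (fun _ => 1) ⊓ Formula.not (BoundedFormula.subst φ fun _ => t)
  have hβ : ∀ x (v : Fin 2 → S x), β.Realize v ↔ (φ.Realize fun _ => v 0) ∧ (φ.Realize fun _ => v 1) ∧
      ¬ φ.Realize fun _ => t.realize v := by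
    intro x v
    simp only [β, Formula.realize_inf, Formula.realize_relabel, Formula.realize_not, and_assoc]
    simp only [Formula.Realize, BoundedFormula.realize_subst]
    rfl
  obtain ⟨g, g', hg⟩ := h.exists_pair β fun x v hv i => by
    rw [hβ] at hv
    fin_cases i
    exacts [hv.1, hv.2.1]
  refine ((ha.union hb).union (h.finite_not (t.realize ![g, g']))).subset fun x hx => ?_
  by_contra hn
  simp only [Set.mem_union, Set.mem_ofPred_eq, not_or, not_not] at hn hx
  refine ((hβ x _).1 (hg x ⟨![a x, b x], (hβ x _).2 ⟨hn.1.1, hn.1.2, hx⟩⟩)).2.2 ?_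
  convert hn.2 using 2
  rw [← realize_term_map]
  congr 1
  ext j; fin_cases j <;> rfl

/-- The families which satisfy `φ` at all but finitely many indices. -/
def StalkFrame.restrictedProduct (h : StalkFrame φ S π 𝓑) : Subring (∀ x, S x) where
  carrier := {a | {x | ¬ φ.Realize fun _ => a x}.Finite}
  zero_mem' := by simpa using h.finite_not 0
  one_mem' := by simpa using h.finite_not 1
  add_mem' ha hb := by simpa using h.finite_not_term (.var 0 + .var 1) ha hb
  mul_mem' ha hb := by simpa using h.finite_not_term (.var 0 * .var 1) ha hb
  neg_mem' ha := by simpa using h.finite_not_term (-.var 0) ha ha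

theorem exists_infinite_subset {X : Type*} {Y : Set X} (hY : Y.Infinite) :
    ∃ Z ⊆ Y, Z.Infinite ∧ (Y \ Z).Infinite := by
  let f := hY.natEmbedding
  have hf : ∀ m n, (f m : X) = f n ↔ m = n := fun m n => by
    rw [← Subtype.ext_iff, f.injective.eq_iff]
  refine ⟨Set.range fun n => (f (2 * n) : X), ?_, Set.infinite_range_of_injective ?_,
    (Set.infinite_range_of_injective (f := fun n => (f (2 * n + 1) : X)) ?_).mono ?_⟩
  · rintro _ ⟨n, rfl⟩
    exact (f (2 * n)).2
  · intro m n hmn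
    have := (hf _ _).1 hmn
    omega
  · intro m n hmn
    have := (hf _ _).1 hmn
    omega
  · rintro _ ⟨n, rfl⟩
    refine ⟨(f (2 * n + 1)).2, ?_⟩
    rintro ⟨m, hm⟩
    have := (hf _ _).1 hm
    omega

/-- Witnesses are chosen index by index, inside `φ` whenever possible; the family then violates `φ`
only on the finite exceptional set. -/
theorem StalkFrame.restrictedProduct_stalkFrame (h : StalkFrame φ S π 𝓑) :
    StalkFrame φ S (fun x => (Pi.evalRingHom S x).comp h.restrictedProduct.subtype) Set.univ where
  nontrivial := h.nontrivial
  eq_zero a ha := Subtype.ext (funext ha)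
  compl_mem _ _ := trivial
  inter_mem _ _ _ _ := trivial
  mem_of_finite _ _ := trivial
  split Y _ hY := by
    obtain ⟨Z, hZ⟩ := exists_infinite_subset hY
    exact ⟨Z, trivial, hZ⟩
  exists_indicator Y _ := by
    classical
    refine ⟨⟨fun x => if x ∈ Y then 1 else 0, ?_⟩, fun x => ⟨fun hx => ?_, fun hx => ?_⟩⟩
    -- The constants 0 and 1 come from `A`, so each satisfies `φ` almost everywhere.
    · refine ((h.finite_not 0).union (h.finite_not 1)).subset fun x hx => ?_
      simp only [map_zero, map_one]
      by_cases hxY : x ∈ Y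
      · exact Or.inr (by simpa [hxY] using hx)
      · exact Or.inl (by simpa [hxY] using hx)
    · simp [hx]
    · simp [hx]
  finite_not a := a.2
  sat_mem _ _ _ := trivial
  glue n Θ f h₁ h₂ := by
    have : ∀ x, ∃ w : S x, Θ.Realize (Sum.elim (fun i => (f i : ∀ x, S x) x) fun _ => w) ∧
        ((∃ w : S x, φ.Realize (fun _ => w) ∧
          Θ.Realize (Sum.elim (fun i => (f i : ∀ x, S x) x) fun _ => w)) →
            φ.Realize fun _ => w) := by
      intro x
      by_cases hx : ∃ w : S x, φ.Realize (fun _ => w) ∧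
          Θ.Realize (Sum.elim (fun i => (f i : ∀ x, S x) x) fun _ => w)
      · obtain ⟨w, hw⟩ := hx
        exact ⟨w, hw.2, fun _ => hw.1⟩
      · exact (h₁ x).imp fun w hw => ⟨hw, fun hn => absurd hn hx⟩
    choose g hg hg' using this
    exact ⟨⟨g, h₂.subset fun x hx hn => hx (hg' x hn)⟩, hg⟩

end RestrictedProduct

/-! ### Sizes of sets up to a threshold. -/

section Sizes

/-- Two sizes agree, or are both at least `N` and both finite or both infinite. -/
def SizeEquiv (N : ℕ) (a b : ℕ∞) : Prop := a = b ∨ (N ≤ a ∧ N ≤ b ∧ (a = ⊤ ↔ b = ⊤))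

theorem SizeEquiv.symm {N : ℕ} {a b : ℕ∞} (h : SizeEquiv N a b) : SizeEquiv N b a :=
  h.imp Eq.symm fun h => ⟨h.2.1, h.1, h.2.2.symm⟩

theorem SizeEquiv.eq_top_iff {N : ℕ} {a b : ℕ∞} (h : SizeEquiv N a b) : a = ⊤ ↔ b = ⊤ :=
  h.elim (fun h => by rw [h]) fun h => h.2.2

theorem SizeEquiv.eq_zero_iff {N : ℕ} (hN : 0 < N) {a b : ℕ∞} (h : SizeEquiv N a b) :
    a = 0 ↔ b = 0 := by
  rcases h with rfl | ⟨ha, hb, -⟩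
  · rfl
  · have : (0 : ℕ∞) < N := by exact_mod_cast hN
    exact iff_of_false (this.trans_le ha).ne' (this.trans_le hb).ne'

theorem SizeEquiv.add {N : ℕ} {a b c d : ℕ∞} (h : SizeEquiv N a b) (h' : SizeEquiv N c d) :
    SizeEquiv N (a + c) (b + d) := by
  have htop : a + c = ⊤ ↔ b + d = ⊤ := by
    rw [ENat.add_eq_top, ENat.add_eq_top, h.eq_top_iff, h'.eq_top_iff]
  rcases h with rfl | ⟨ha, hb, -⟩
  · rcases h' with rfl | ⟨hc, hd, -⟩
    · exact .inl rfl
    · exact .inr ⟨hc.trans le_add_self, hd.trans le_add_self, htop⟩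
  · exact .inr ⟨ha.trans le_self_add, hb.trans le_self_add, htop⟩

theorem SizeEquiv.mono {M N : ℕ} (hMN : M ≤ N) {a b : ℕ∞} (h : SizeEquiv N a b) :
    SizeEquiv M a b := by
  have : (M : ℕ∞) ≤ N := by exact_mod_cast hMN
  exact h.imp id fun h => ⟨this.trans h.1, this.trans h.2.1, h.2.2⟩

/-- The threshold doubles because two numbers with sum at least `2 * N` are not both below `N`: a
part below `N` is matched exactly and the remainder of `Y` is still at least `N`. The axiom `split`
is needed only when `b` and `c` are both infinite. -/
theorem SplittingAlgebra.exists_subset {X : Type*} {𝓑 : Set (Set X)} (h : SplittingAlgebra 𝓑)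
    {N : ℕ} {b c : ℕ∞} {Y : Set X} (hY : Y ∈ 𝓑) (hs : SizeEquiv (2 * N) (b + c) Y.encard) :
    ∃ Z ∈ 𝓑, Z ⊆ Y ∧ SizeEquiv N b Z.encard ∧ SizeEquiv N c (Y \ Z).encard := by
  rcases Set.finite_or_infinite Y with hfin | hinf
  · have hsub : ∀ n m : ℕ, Y.encard = (n + m : ℕ) →
        ∃ Z ∈ 𝓑, Z ⊆ Y ∧ Z.encard = n ∧ (Y \ Z).encard = m := by
      intro n m hnm
      obtain ⟨Z, hZ, hn⟩ := Set.exists_subset_encard_eq (s := Y) (k := n)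
        (by rw [hnm]; exact_mod_cast Nat.le_add_right n m)
      refine ⟨Z, h.mem_of_finite _ (hfin.subset hZ), hZ, hn, ?_⟩
      have := Set.encard_sdiff_add_encard_of_subset hZ
      rw [hn, hnm, Nat.cast_add, add_comm (n : ℕ∞)] at this
      exact ENat.add_left_injective_of_ne_top (ENat.natCast_ne_top n) this
    obtain ⟨k, hk⟩ := ENat.ne_top_iff_exists.1 (Set.encard_ne_top_iff.2 hfin)
    have hbc : b + c ≠ ⊤ := fun ht => Set.encard_ne_top_iff.2 hfin (hs.eq_top_iff.1 ht)
    rw [ne_eq, ENat.add_eq_top, not_or] at hbc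
    lift b to ℕ using hbc.1
    lift c to ℕ using hbc.2
    rw [← hk] at hs
    have hs' : b + c = k ∨ (2 * N ≤ b + c ∧ 2 * N ≤ k) := by
      rcases hs with hs | ⟨h₁, h₂, -⟩
      · exact .inl (by exact_mod_cast hs)
      · exact .inr ⟨by exact_mod_cast h₁, by exact_mod_cast h₂⟩
    have key : ∃ n m : ℕ, k = n + m ∧ (b = n ∨ N ≤ b ∧ N ≤ n) ∧ (c = m ∨ N ≤ c ∧ N ≤ m) := by
      rcases hs' with hs' | ⟨h₁, h₂⟩
      · exact ⟨b, c, hs'.symm, .inl rfl, .inl rfl⟩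
      · by_cases hb : b < N
        · exact ⟨b, k - b, by omega, .inl rfl, .inr (by omega)⟩
        · by_cases hc : c < N
          · exact ⟨k - c, c, by omega, .inr (by omega), .inl rfl⟩
          · exact ⟨N, k - N, by omega, .inr (by omega), .inr (by omega)⟩
    obtain ⟨n, m, hnm, hn, hm⟩ := key
    obtain ⟨Z, hZB, hZ, h₁, h₂⟩ := hsub n m (by rw [← hk, hnm])
    refine ⟨Z, hZB, hZ, ?_, ?_⟩
    · rw [h₁]
      exact hn.imp (fun h => by rw [h]) fun h => ⟨by exact_mod_cast h.1, by exact_mod_cast h.2,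
        by simp⟩
    · rw [h₂]
      exact hm.imp (fun h => by rw [h]) fun h => ⟨by exact_mod_cast h.1, by exact_mod_cast h.2,
        by simp⟩
  · have hsub : ∀ n : ℕ, ∃ Z ∈ 𝓑, Z ⊆ Y ∧ Z.encard = n ∧ (Y \ Z).encard = ⊤ := by
      intro n
      obtain ⟨Z, hZ, hn⟩ := Set.exists_subset_encard_eq (s := Y) (k := n)
        (by rw [Set.encard_eq_top_iff.2 hinf]; exact le_top)
      have hZf : Z.Finite := Set.finite_of_encard_eq_coe hn
      exact ⟨Z, h.mem_of_finite _ hZf, hZ, hn, Set.encard_eq_top_iff.2 (hinf.sdiff hZf)⟩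
    have hbc : b + c = ⊤ := hs.eq_top_iff.2 (Set.encard_eq_top_iff.2 hinf)
    by_cases hb : b = ⊤
    · subst hb
      by_cases hc : c = ⊤
      · subst hc
        obtain ⟨Z, hZB, hZ, h₁, h₂⟩ := h.split Y hY hinf
        exact ⟨Z, hZB, hZ, .inl (Set.encard_eq_top_iff.2 h₁).symm,
          .inl (Set.encard_eq_top_iff.2 h₂).symm⟩
      · lift c to ℕ using hc
        obtain ⟨Z, hZB, hZ, h₁, h₂⟩ := hsub c
        refine ⟨Y \ Z, h.inter_mem _ hY _ (h.compl_mem _ hZB), Set.sdiff_subset, .inl h₂.symm, ?_⟩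
        rw [Set.sdiff_sdiff_cancel_left hZ]
        exact .inl h₁.symm
    · have hc : c = ⊤ := (ENat.add_eq_top.1 hbc).resolve_left hb
      subst hc
      lift b to ℕ using hb
      obtain ⟨Z, hZB, hZ, h₁, h₂⟩ := hsub b
      exact ⟨Z, hZB, hZ, .inl h₁.symm, .inl h₂.symm⟩

end Sizes

/-! ### Matching refinements of finite colourings. -/

section Colorings

variable {X Y C D : Type*}

/-- The colour classes of two colourings have equivalent sizes. -/
def ColorEquiv (N : ℕ) (t : X → C) (t' : Y → C) : Prop :=
  ∀ c, SizeEquiv N (t ⁻¹' {c}).encard (t' ⁻¹' {c}).encard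

theorem ColorEquiv.symm {N : ℕ} {t : X → C} {t' : Y → C} (h : ColorEquiv N t t') :
    ColorEquiv N t' t := fun c => (h c).symm

theorem ColorEquiv.mono {M N : ℕ} (hMN : M ≤ N) {t : X → C} {t' : Y → C} (h : ColorEquiv N t t') :
    ColorEquiv M t t' := fun c => (h c).mono hMN

/-- A finite disjoint union of colour classes: by `SizeEquiv.add`, sums of equivalent sizes are
equivalent with the same threshold. -/
theorem ColorEquiv.preimage [Finite C] {N : ℕ} {t : X → C} {t' : Y → C} (h : ColorEquiv N t t')
    (U : Set C) : SizeEquiv N (t ⁻¹' U).encard (t' ⁻¹' U).encard := by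
  induction U, U.toFinite using Set.Finite.induction_on with
  | empty => exact .inl (by simp)
  | @insert c U hc _ ih =>
    have hd : ∀ {Z : Type _} (s : Z → C), Disjoint (s ⁻¹' {c}) (s ⁻¹' U) := fun s =>
      Disjoint.preimage s (Set.disjoint_singleton_left.2 hc)
    rw [Set.insert_eq, Set.preimage_union, Set.preimage_union, Set.encard_union_eq (hd t),
      Set.encard_union_eq (Disjoint.preimage t' (Set.disjoint_singleton_left.2 hc))]
    exact (h c).add ih

theorem ColorEquiv.comp [Finite C] {N : ℕ} {t : X → C} {t' : Y → C} (h : ColorEquiv N t t')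
    (r : C → D) : ColorEquiv N (r ∘ t) (r ∘ t') := fun d => h.preimage (r ⁻¹' {d})

/-- All colour classes belong to the algebra. -/
def ColorMem (𝓑 : Set (Set X)) (t : X → C) : Prop := ∀ c, t ⁻¹' {c} ∈ 𝓑

theorem SplittingAlgebra.union_mem {𝓑 : Set (Set X)} (h : SplittingAlgebra 𝓑) {U V : Set X}
    (hU : U ∈ 𝓑) (hV : V ∈ 𝓑) : U ∪ V ∈ 𝓑 := by
  rw [← compl_compl (U ∪ V), Set.compl_union]
  exact h.compl_mem _ (h.inter_mem _ (h.compl_mem _ hU) _ (h.compl_mem _ hV))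

theorem SplittingAlgebra.preimage_mem [Finite C] {𝓑 : Set (Set X)} (h : SplittingAlgebra 𝓑)
    {t : X → C} (ht : ColorMem 𝓑 t) (U : Set C) : t ⁻¹' U ∈ 𝓑 := by
  induction U, U.toFinite using Set.Finite.induction_on with
  | empty => exact h.mem_of_finite _ (by simp)
  | @insert c U hc _ ih =>
    rw [Set.insert_eq, Set.preimage_union]
    exact h.union_mem (ht c) ih

/-- Each colour class of `t'` is cut separately, by `exists_subset`, in the proportions in which `p`
cuts the corresponding class of `t`. -/
theorem SplittingAlgebra.exists_split [Finite C] {𝓑 : Set (Set Y)} (h : SplittingAlgebra 𝓑) {N : ℕ}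
    {t : X → C} {t' : Y → C} (ht : ColorEquiv (2 * N) t t') (ht' : ColorMem 𝓑 t') (p : X → Prop) :
    ∃ p' : Y → Prop, ColorMem 𝓑 (fun y => (t' y, p' y)) ∧
      ColorEquiv N (fun x => (t x, p x)) (fun y => (t' y, p' y)) := by
  have hp : ∀ c, (t ⁻¹' {c} ∩ {x | p x}).encard + (t ⁻¹' {c} \ {x | p x}).encard =
      (t ⁻¹' {c}).encard := fun c => by rw [add_comm, Set.encard_sdiff_add_encard_inter]
  choose Z hZB hZ h₁ h₂ using fun c => h.exists_subset (ht' c) (by rw [hp c]; exact ht c)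
  have hpos : ∀ c, (fun y => (t' y, y ∈ Z (t' y))) ⁻¹' {(c, True)} = Z c := by
    intro c
    ext y
    simp only [Set.mem_preimage, Set.mem_singleton_iff, Prod.mk.injEq, eq_iff_iff, iff_true]
    exact ⟨fun ⟨e, hy⟩ => e ▸ hy, fun hy => by
      have : t' y = c := hZ c hy
      exact ⟨this, by rwa [this]⟩⟩
  have hneg : ∀ c, (fun y => (t' y, y ∈ Z (t' y))) ⁻¹' {(c, False)} = t' ⁻¹' {c} \ Z c := by
    intro c
    ext y
    simp only [Set.mem_preimage, Set.mem_singleton_iff, Prod.mk.injEq, eq_iff_iff, iff_false,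
      Set.mem_sdiff]
    refine and_congr_right fun e => ?_
    rw [e]
  refine ⟨fun y => y ∈ Z (t' y), ?_, ?_⟩
  · rintro ⟨c, q⟩
    by_cases hq : q
    · rw [eq_true hq, hpos]
      exact hZB c
    · rw [eq_false hq, hneg]
      exact h.inter_mem _ (ht' c) _ (h.compl_mem _ (hZB c))
  · rintro ⟨c, q⟩
    by_cases hq : q
    · rw [eq_true hq, hpos]
      convert h₁ c using 2
      ext x
      simp
    · rw [eq_false hq, hneg]
      convert h₂ c using 2
      ext x
      simp

/-- Back and forth: a refinement of a colouring is matched by one of an equivalent colouring. -/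
theorem exists_refinement (ι : Type) [Finite ι] : ∀ N : ℕ, ∃ M, N ≤ M ∧
    ∀ {X Y : Type u} {C : Type} [Finite C] {𝓑 : Set (Set Y)} (_ : SplittingAlgebra 𝓑)
      {t : X → C} {t' : Y → C} (_ : ColorEquiv M t t') (_ : ColorMem 𝓑 t') (s : X → Set ι),
      ∃ s' : Y → Set ι, ColorMem 𝓑 (fun y => (t' y, s' y)) ∧
        ColorEquiv N (fun x => (t x, s x)) (fun y => (t' y, s' y)) := by
  -- Finiteness of `ι` is carried along in the induction, as the colour sets `C × Set ι` must be
  -- finite.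
  refine And.right (a := Finite ι) ?_
  induction ι using Finite.induction_empty_option with
  | @of_equiv α β e ih =>
    obtain ⟨_, ih⟩ := ih
    refine ⟨.of_equiv α e, fun N => ?_⟩
    obtain ⟨M, hM, H⟩ := ih N
    refine ⟨M, hM, fun {X Y C} _ {𝓑} h {t t'} ht ht' s => ?_⟩
    obtain ⟨s', h₁, h₂⟩ := H h ht ht' fun x => e ⁻¹' s x
    have hs : (fun x => (t x, s x)) = (fun p => (p.1, e.symm ⁻¹' p.2)) ∘
        fun x => (t x, e ⁻¹' s x) := by
      ext x
      · rfl
      · simp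
    refine ⟨fun y => e.symm ⁻¹' s' y, fun c => ?_, ?_⟩
    · exact h.preimage_mem h₁ ((fun p : C × Set α => (p.1, e.symm ⁻¹' p.2)) ⁻¹' {c})
    · rw [hs]
      exact h₂.comp fun p => (p.1, e.symm ⁻¹' p.2)
  | h_empty =>
    refine ⟨inferInstance, fun N => ?_⟩
    refine ⟨N, le_rfl, fun {X Y C} _ {𝓑} h {t t'} ht ht' s => ⟨fun _ => ∅, ?_, ?_⟩⟩
    · exact fun c => h.preimage_mem ht' ((fun c => (c, ∅)) ⁻¹' {c})
    · rw [show s = fun _ => ∅ from funext fun x => Subsingleton.elim _ _]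
      exact ht.comp fun c => (c, ∅)
  | @h_option ι _ ih =>
    obtain ⟨_, ih⟩ := ih
    refine ⟨inferInstance, fun N => ?_⟩
    obtain ⟨M, hM, H⟩ := ih N
    refine ⟨2 * M, by omega, fun {X Y C} _ {𝓑} h {t t'} ht ht' s => ?_⟩
    -- Membership of `none` is matched first, at the cost of doubling the threshold, and is then
    -- absorbed into the colour before the induction hypothesis is used.
    obtain ⟨p', hp₁, hp₂⟩ := h.exists_split ht ht' fun x => none ∈ s x
    obtain ⟨s', h₁, h₂⟩ := H h hp₂ hp₁ fun x => some ⁻¹' s x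
    let r : (C × Prop) × Set ι → C × Set (Option ι) := fun p =>
      (p.1.1, {o | o.elim p.1.2 (· ∈ p.2)})
    have hs : (fun x => (t x, s x)) = r ∘ fun x => ((t x, none ∈ s x), some ⁻¹' s x) := by
      ext x o
      · rfl
      · cases o <;> simp [r]
    refine ⟨fun y => (r ((t' y, p' y), s' y)).2, fun c => ?_, ?_⟩
    · exact h.preimage_mem h₁ (r ⁻¹' {c})
    · rw [hs]
      exact h₂.comp r

end Colorings

/-! ### Back and forth between two frames with the same stalks. -/

section ElementaryEquivalence

variable {φ : Language.ring.Formula (Fin 1)} {X : Type u} {S : X → Type u}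
  [∀ x, CommRing (S x)]

/-- The set of formulas of a family that hold at an index. -/
def typeAt {α ι : Type*} {n : ℕ} (η : ι → Language.ring.BoundedFormula α n) {A : Type u}
    [CommRing A] (π : ∀ x, A →+* S x) (f : α → A) (xs : Fin n → A) (x : X) : Set ι :=
  {i | (η i).Realize (π x ∘ f) (π x ∘ xs)}

theorem StalkFrame.colorMem_typeAt {A : Type u} [CommRing A] {π : ∀ x, A →+* S x} {𝓑 : Set (Set X)}
    (h : StalkFrame φ S π 𝓑) {α ι : Type*} [Finite α] [Finite ι] {n : ℕ}
    (η : ι → Language.ring.BoundedFormula α n) (f : α → A) (xs : Fin n → A) :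
    ColorMem 𝓑 (typeAt η π f xs) := by
  intro d
  have : typeAt η π f xs ⁻¹' {d} =
      {x | (BoundedFormula.iInf fun i : ι => (η i).iff (open Classical in if i ∈ d then ⊤ else ⊥)).Realize
        (π x ∘ f) (π x ∘ xs)} := by
    ext x
    simp only [Set.mem_preimage, Set.mem_singleton_iff, Set.ext_iff, Set.mem_ofPred_eq,
      BoundedFormula.realize_iInf, BoundedFormula.realize_iff]
    refine forall_congr' fun i => iff_congr Iff.rfl ?_
    by_cases hi : i ∈ d <;> simp [hi]
  rw [this]
  exact h.setOf_realize_mem _ f xs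

/-- The formulas `∃ w, η(w) = d` and `∃ w, φ(w) ∧ η(w) = d`, where `η(w) = d` says that exactly the
formulas `η i` with `i ∈ d` hold. -/
noncomputable def exType (φ : Language.ring.Formula (Fin 1)) {α ι : Type*} [Finite ι] {n : ℕ}
    (η : ι → Language.ring.BoundedFormula α (n + 1)) (p : Set ι × Prop) :
    Language.ring.BoundedFormula α n :=
  BoundedFormula.ex
    ((open Classical in if p.2 then
        BoundedFormula.relabel (n := n + 1)
          (fun _ => (Sum.inr (Fin.last n) : α ⊕ Fin (n + 1))) φ else ⊤) ⊓
      BoundedFormula.iInf fun i : ι => (η i).iff (open Classical in if i ∈ p.1 then ⊤ else ⊥))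

theorem realize_relabel_last {α : Type*} {n : ℕ} {A : Type*} [CommRing A] (v : α → A)
    (xs : Fin n → A) (w : A) (φ : Language.ring.Formula (Fin 1)) :
    BoundedFormula.Realize (l := n + 1) (BoundedFormula.relabel (n := n + 1)
      (fun _ => (Sum.inr (Fin.last n) : α ⊕ Fin (n + 1))) φ) v (Fin.snoc xs w) ↔
      φ.Realize fun _ => w := by
  refine BoundedFormula.realize_relabel.trans (iff_of_eq ?_)
  rw [Formula.Realize]
  congr 1
  · ext i
    simp
  · exact Subsingleton.elim _ _

theorem realize_exType {α ι : Type*} [Finite ι] {n : ℕ}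
    (η : ι → Language.ring.BoundedFormula α (n + 1)) (d : Set ι) (q : Prop) {A : Type*} [CommRing A]
    (v : α → A) (xs : Fin n → A) : (exType φ η (d, q)).Realize v xs ↔
      ∃ w, (q → φ.Realize fun _ => w) ∧ ∀ i, (η i).Realize v (Fin.snoc xs w) ↔ i ∈ d := by
  simp only [exType, BoundedFormula.realize_ex, BoundedFormula.realize_inf,
    BoundedFormula.realize_iInf, BoundedFormula.realize_iff]
  refine exists_congr fun w => and_congr ?_ (forall_congr' fun i => iff_congr Iff.rfl ?_)
  · by_cases hq : q
    · simp only [hq, if_true, forall_const]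
      exact realize_relabel_last v xs w φ
    · simp [hq]
  · by_cases hi : i ∈ d <;> simp [hi]

theorem comp_snoc {A B : Type*} (g : A → B) {n : ℕ} (xs : Fin n → A) (w : A) :
    g ∘ (Fin.snoc xs w : Fin (n + 1) → A) = Fin.snoc (g ∘ xs) (g w) :=
  Fin.comp_snoc g xs w

/-- The types of `w` refine the colouring by `exType`. The refinement is transported to the other
frame, where gluing realises it by an element `w'`; the types in `exType` guarantee that the local
witnesses required for gluing exist. -/
theorem StalkFrame.exists_matching {ι α : Type} [Finite ι] [Finite α] {n : ℕ}
    (η : ι → Language.ring.BoundedFormula α (n + 1)) {N M : ℕ} (hN : 0 < N)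
    (hM : ∀ {X Y : Type u} {C : Type} [Finite C] {𝓑 : Set (Set Y)} (_ : SplittingAlgebra 𝓑)
      {t : X → C} {t' : Y → C} (_ : ColorEquiv M t t') (_ : ColorMem 𝓑 t') (s : X → Set ι),
      ∃ s' : Y → Set ι, ColorMem 𝓑 (fun y => (t' y, s' y)) ∧
        ColorEquiv N (fun x => (t x, s x)) (fun y => (t' y, s' y)))
    {A A' : Type u} [CommRing A] [CommRing A'] {π : ∀ x, A →+* S x} {π' : ∀ x, A' →+* S x}
    {𝓑 𝓑' : Set (Set X)} (h : StalkFrame φ S π 𝓑) (h' : StalkFrame φ S π' 𝓑')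
    {f : α → A} {f' : α → A'} {xs : Fin n → A} {xs' : Fin n → A'}
    (ht : ColorEquiv M (typeAt (exType φ η) π f xs) (typeAt (exType φ η) π' f' xs')) (w : A) :
    ∃ w' : A', ColorEquiv N (typeAt η π f (Fin.snoc xs w)) (typeAt η π' f' (Fin.snoc xs' w')) := by
  obtain ⟨s', h₁, h₂⟩ := hM h'.toSplittingAlgebra ht (h'.colorMem_typeAt _ _ _)
    (typeAt η π f (Fin.snoc xs w))
  have hw : ∀ x i, (η i).Realize (π x ∘ f) (Fin.snoc (π x ∘ xs) (π x w)) ↔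
      i ∈ typeAt η π f (Fin.snoc xs w) x := by
    intro x i
    rw [← comp_snoc]
    rfl
  obtain ⟨w', hw'⟩ := h'.exists_forall_realize_iff η f' xs' (fun i => {x | i ∈ s' x})
    (fun i => h'.preimage_mem h₁ {p | i ∈ p.2})
    (fun x => by
      -- The combined colour of `x` occurs in the first frame too, say at `y`. There `w` realises
      -- the type `s' x`, so this type is realisable at `y`, and hence at `x`, which has the same
      -- `exType` colour.
      have hne := (h₂ (typeAt (exType φ η) π' f' xs' x, s' x)).eq_zero_iff hN
      rw [Set.encard_eq_zero, Set.encard_eq_zero] at hne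
      obtain ⟨y, hy⟩ := Set.nonempty_iff_ne_empty.2
        (fun he => Set.notMem_empty x (hne.1 he ▸ (show _ ∈ _ from rfl)))
      simp only [Set.mem_preimage, Set.mem_singleton_iff, Prod.mk.injEq] at hy
      have : (s' x, False) ∈ typeAt (exType φ η) π' f' xs' x := by
        rw [← hy.1]
        exact (realize_exType η _ _ _ _).2 ⟨π y w, False.elim, fun i => by rw [hw, hy.2]⟩
      obtain ⟨v, -, hv⟩ := (realize_exType η _ _ _ _).1 this
      exact ⟨v, hv⟩)
    (by
      -- Where the type of `w` is not realised inside `φ`, `w` itself violates `φ`. This finite set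
      -- is a union of colour classes, so its counterpart in the other frame is finite as well.
      have hfin : {x | (typeAt η π f (Fin.snoc xs w) x, True) ∉
          typeAt (exType φ η) π f xs x}.Finite :=
        (h.finite_not w).subset fun x hx hn => hx ((realize_exType η _ _ _ _).2
          ⟨π x w, fun _ => hn, fun i => hw x i⟩)
      have := (h₂.preimage {p | (p.2, True) ∉ p.1}).eq_top_iff
      rw [Set.encard_eq_top_iff, Set.encard_eq_top_iff, ← not_iff_not, Set.not_infinite,
        Set.not_infinite] at this
      refine (this.1 hfin).subset fun x hx hn => hx ?_
      obtain ⟨v, hv, hv'⟩ := (realize_exType η _ _ _ _).1 hn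
      exact ⟨v, hv trivial, hv'⟩)
  refine ⟨w', ?_⟩
  have : typeAt η π' f' (Fin.snoc xs' w') = s' := by
    ext x i
    change BoundedFormula.Realize _ _ _ ↔ _
    rw [comp_snoc]
    exact hw' x i
  rw [this]
  exact h₂.comp Prod.snd

/-- The truth value of a formula in a frame only depends, for a suitable finite family of formulas
and a suitable threshold, on the sizes of the sets of indices with a given type. -/
theorem exists_typeAt_determines {α : Type} [Finite α] {n : ℕ}
    (θ : Language.ring.BoundedFormula α n) :
    ∃ (ι : Type) (_ : Finite ι) (η : ι → Language.ring.BoundedFormula α n) (N : ℕ), 0 < N ∧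
      ∀ {A A' : Type u} [CommRing A] [CommRing A'] {π : ∀ x, A →+* S x} {π' : ∀ x, A' →+* S x}
        {𝓑 𝓑' : Set (Set X)} (_ : StalkFrame φ S π 𝓑) (_ : StalkFrame φ S π' 𝓑')
        {f : α → A} {f' : α → A'} {xs : Fin n → A} {xs' : Fin n → A'},
        ColorEquiv N (typeAt η π f xs) (typeAt η π' f' xs') →
          (θ.Realize f xs ↔ θ.Realize f' xs') := by
  induction θ with
  | falsum => exact ⟨Empty, inferInstance, fun i => i.elim, 1, one_pos, by intros; rfl⟩
  | @equal n t₁ t₂ =>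
    refine ⟨Unit, inferInstance, fun _ => .equal t₁ t₂, 1, one_pos, ?_⟩
    intro A A' _ _ π π' 𝓑 𝓑' h h' f f' xs xs' ht
    -- An equation holds if and only if no stalk refutes it; emptiness is visible at threshold 1.
    have key : ∀ {A : Type u} [CommRing A] {π : ∀ x, A →+* S x} {𝓑 : Set (Set X)}
        (_ : StalkFrame φ S π 𝓑) (f : α → A) (xs : Fin n → A),
        (BoundedFormula.equal t₁ t₂).Realize f xs ↔
          (typeAt (fun _ : Unit => .equal t₁ t₂) π f xs ⁻¹' {d | () ∉ d}).encard = 0 := by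
      intro A _ π 𝓑 h f xs
      refine (h.realize_equal_iff t₁ t₂ (Sum.elim f xs)).trans ?_
      rw [Set.encard_eq_zero, Set.eq_empty_iff_forall_notMem]
      refine forall_congr' fun x => ?_
      rw [Sum.comp_elim]
      simp only [Set.mem_preimage, Set.mem_ofPred_eq, not_not]
      rfl
    rw [key h, key h', (ht.preimage _).eq_zero_iff one_pos]
  | rel R => exact R.elim
  | imp θ₁ θ₂ ih₁ ih₂ =>
    obtain ⟨ι₁, _, η₁, N₁, hN₁, H₁⟩ := ih₁
    obtain ⟨ι₂, _, η₂, N₂, hN₂, H₂⟩ := ih₂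
    refine ⟨ι₁ ⊕ ι₂, inferInstance, Sum.elim η₁ η₂, max N₁ N₂, by omega, ?_⟩
    intro A A' _ _ π π' 𝓑 𝓑' h h' f f' xs xs' ht
    refine imp_congr (H₁ h h' ?_) (H₂ h h' ?_)
    · exact (ht.comp (Sum.inl ⁻¹' ·)).mono (le_max_left _ _)
    · exact (ht.comp (Sum.inr ⁻¹' ·)).mono (le_max_right _ _)
  | all θ ih =>
    obtain ⟨ι, _, η, N, hN, H⟩ := ih
    obtain ⟨M, hNM, hM⟩ := exists_refinement.{u} ι N
    refine ⟨Set ι × Prop, inferInstance, exType φ η, M, by omega, ?_⟩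
    intro A A' _ _ π π' 𝓑 𝓑' h h' f f' xs xs' ht
    simp only [BoundedFormula.realize_all]
    constructor
    · intro hA w'
      obtain ⟨w, hw⟩ := h'.exists_matching η hN hM h ht.symm w'
      exact (H h h' hw.symm).1 (hA w)
    · intro hA w
      obtain ⟨w', hw⟩ := h.exists_matching η hN hM h' ht w
      exact (H h h' hw).2 (hA w')

theorem SatisfiesAxioms.exists_restrictedProduct {R : Type u} [CommRing R]
    (h : SatisfiesAxioms φ R) : ∃ P : Subring (∀ e : Atoms R, Stalk e.1),
      (∀ a, a ∈ P ↔ {e | ¬ RingSat φ (fun _ => a e)}.Finite) ∧ RingElemEquiv R P := by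
  refine ⟨h.stalkFrame.restrictedProduct, fun a => Iff.rfl, ?_⟩
  refine (elementarilyEquivalent_iff ..).2 fun θ => ?_
  obtain ⟨ι, _, η, N, hN, H⟩ := exists_typeAt_determines (φ := φ) (X := Atoms R)
    (S := fun e => Stalk e.1) θ
  -- The type of an atom for formulas without free variables depends on its stalk alone, so the two
  -- colourings are equal.
  refine H h.stalkFrame h.stalkFrame.restrictedProduct_stalkFrame fun d => .inl ?_
  congr 2
  ext x i
  refine iff_of_eq ?_
  change BoundedFormula.Realize _ _ _ = BoundedFormula.Realize _ _ _
  congr 1 <;> exact Subsingleton.elim _ _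

end ElementaryEquivalence

/-! ### Computability of recursion on trees with changing parameters. -/

section TreeRecursion

open Nat.Partrec (Code)

variable {α σ : Type*}

/-- Recursion on a natural number which calls itself on two smaller numbers with new values of the
parameter, the second of which may depend on the result of the first call. -/
def treeRec (base : α → σ) (l r : ℕ × α → ℕ) (p : ℕ × α → α) (q : (ℕ × α) × σ → α)
    (comb : (ℕ × α) × σ × σ → σ) (hl : ∀ x, l x ≤ x.1) (hr : ∀ x, r x ≤ x.1) : ℕ → α → σ
  | 0, a => base a
  | c + 1, a =>
    let u := treeRec base l r p q comb hl hr (l (c, a)) (p (c, a))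
    comb ((c, a), u, treeRec base l r p q comb hl hr (r (c, a)) (q ((c, a), u)))
termination_by c => c
decreasing_by
  · exact Nat.lt_succ_of_le (hl (c, a))
  · exact Nat.lt_succ_of_le (hr (c, a))

/-- Kleene's recursion theorem gives a code `e` that evaluates `body` with recursive calls made to
`e` itself. As both calls are at smaller numbers, strong induction shows that `e` halts with the
value of `treeRec`. -/
theorem computable_treeRec [Primcodable α] [Primcodable σ] {base : α → σ} {l r : ℕ × α → ℕ}
    {p : ℕ × α → α} {q : (ℕ × α) × σ → α} {comb : (ℕ × α) × σ × σ → σ} {hl : ∀ x, l x ≤ x.1}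
    {hr : ∀ x, r x ≤ x.1} (cbase : Computable base) (cl : Computable l) (cr : Computable r)
    (cp : Computable p) (cq : Computable q) (ccomb : Computable comb) :
    Computable₂ (treeRec base l r p q comb hl hr) := by
  let call : Code → ℕ × α →. σ := fun e y =>
    (e.eval (Encodable.encode y)).bind fun n => Part.ofOption (Encodable.decode n)
  have hcall : Partrec₂ call := by
    refine Partrec.bind (Code.eval_part.comp Computable.fst
      (Computable.encode.comp Computable.snd)) ?_
    exact Computable.ofOption (Computable.decode.comp Computable.snd)
  let body : Code → ℕ × α →. σ := fun e y =>
    Nat.casesOn y.1 (Part.some (base y.2)) fun c =>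
      (call e (l (c, y.2), p (c, y.2))).bind fun u =>
        (call e (r (c, y.2), q ((c, y.2), u))).map fun v => comb ((c, y.2), u, v)
  have hbody : Partrec₂ body := by
    refine Partrec.nat_casesOn_right (f := fun x : Code × ℕ × α => x.2.1)
      (g := fun x => base x.2.2) (Computable.fst.comp Computable.snd)
      (cbase.comp (Computable.snd.comp Computable.snd)) ?_
    have y : Computable fun z : (Code × ℕ × α) × ℕ => (z.2, z.1.2.2) :=
      Computable.snd.pair ((Computable.snd.comp Computable.snd).comp Computable.fst)
    refine Partrec.bind (hcall.comp (Computable.fst.comp Computable.fst)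
      ((cl.comp y).pair (cp.comp y))) ?_
    have y' := y.comp (Computable.fst (α := (Code × ℕ × α) × ℕ) (β := σ))
    refine Partrec.map (hcall.comp
      ((Computable.fst.comp Computable.fst).comp (Computable.fst (β := σ)))
      ((cr.comp y').pair (cq.comp (y'.pair Computable.snd)))) ?_
    have y'' := y'.comp (Computable.fst (β := σ))
    exact ccomb.comp (y''.pair ((Computable.snd.comp Computable.fst).pair Computable.snd))
  obtain ⟨e, he⟩ := Code.fixed_point₂ (f := fun e n =>
      (Part.ofOption (Encodable.decode n : Option (ℕ × α))).bind fun y =>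
        (body e y).map Encodable.encode) (by
    refine Partrec.bind (Computable.ofOption (Computable.decode.comp Computable.snd)) ?_
    refine Partrec.map (hbody.comp (Computable.fst.comp Computable.fst) Computable.snd) ?_
    exact Computable.encode.comp Computable.snd)
  have hcb : ∀ y, call e y = body e y := by
    intro y
    simp only [call, he, Encodable.encodek, Part.coe_some, Part.bind_some, Part.bind_map]
    simp
  have key : ∀ c a, call e (c, a) = Part.some (treeRec base l r p q comb hl hr c a) := by
    intro c
    induction c using Nat.strong_induction_on with
    | _ c ih =>
      intro a
      rw [hcb]
      cases c with
      | zero => simp [body, treeRec]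
      | succ c =>
        rw [treeRec]
        simp only [body]
        rw [ih _ (Nat.lt_succ_of_le (hl (c, a))), Part.bind_some,
          ih _ (Nat.lt_succ_of_le (hr (c, a))), Part.map_some]
  have hp : Partrec (call e) := hcall.comp (Computable.const e) Computable.id
  exact hp.of_eq_tot fun y => by rw [key y.1 y.2]; exact Part.mem_some _

end TreeRecursion

/-! ### Logical operations on Gödel numbers. -/

section Codes

/-- The Gödel number of an implication. -/
def impCode (a b : ℕ) : ℕ := Nat.pair 2 (Nat.pair a b) + 1

/-- The Gödel number of a negation. -/
def notCode (a : ℕ) : ℕ := impCode a 0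

/-- The Gödel number of a conjunction. -/
def andCode (a b : ℕ) : ℕ := notCode (impCode a (notCode b))

/-- The Gödel number of a universal formula. -/
def allCode (a : ℕ) : ℕ := Nat.pair 3 a + 1

/-- The Gödel number of an existential formula. -/
def exCode (a : ℕ) : ℕ := notCode (allCode (notCode a))

/-- The Gödel number of a bound variable. -/
def boundCode (j : ℕ) : ℕ := Nat.pair 1 j + 1

/-- The Gödel number of an application of a function symbol. -/
def funcCode (s : ℕ) (l : List ℕ) : ℕ := Nat.pair 2 (Nat.pair s (Encodable.encode l)) + 1

theorem primrec_impCode : Primrec₂ impCode :=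
  Primrec.succ.comp (Primrec₂.natPair.comp (Primrec.const 2) Primrec₂.natPair)

theorem primrec_notCode : Primrec notCode :=
  primrec_impCode.comp Primrec.id (Primrec.const 0)

theorem primrec_andCode : Primrec₂ andCode :=
  primrec_notCode.comp (primrec_impCode.comp Primrec.fst (primrec_notCode.comp Primrec.snd))

theorem primrec_allCode : Primrec allCode :=
  Primrec.succ.comp (Primrec₂.natPair.comp (Primrec.const 3) Primrec.id)

theorem primrec_exCode : Primrec exCode :=
  primrec_notCode.comp (primrec_allCode.comp primrec_notCode)

theorem primrec_boundCode : Primrec boundCode :=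
  Primrec.succ.comp (Primrec₂.natPair.comp (Primrec.const 1) Primrec.id)

theorem primrec_funcCode : Primrec₂ funcCode :=
  Primrec.succ.comp (Primrec₂.natPair.comp (Primrec.const 2)
    (Primrec₂.natPair.comp Primrec.fst (Primrec.encode.comp Primrec.snd)))

variable {L : FirstOrder.Language.{0, 0}} (cf : ∀ l, L.Functions l → ℕ)
  (cr : ∀ l, L.Relations l → ℕ) {m n : ℕ}

theorem formulaCode_imp (θ₁ θ₂ : L.BoundedFormula (Fin m) n) :
    formulaCode cf cr (θ₁.imp θ₂) = impCode (formulaCode cf cr θ₁) (formulaCode cf cr θ₂) := rfl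

theorem formulaCode_all (θ : L.BoundedFormula (Fin m) (n + 1)) :
    formulaCode cf cr θ.all = allCode (formulaCode cf cr θ) := rfl

end Codes

/-! ### Substitution of a bound variable into `φ`, on Gödel numbers. -/

section Substitution

/-- The numbering of the function symbols of the language of rings. -/
def ringSymbCode : ∀ l, Language.ring.Functions l → ℕ := ringFuncCode

/-- The numbering of the relation symbols of the language of rings. -/
def ringRelCode : ∀ l, Language.ring.Relations l → ℕ := fun _ s => Empty.elim s

theorem ringCode_eq {m : ℕ} (Θ : Language.ring.Formula (Fin m)) :
    ringCode Θ = formulaCode ringSymbCode ringRelCode Θ := rfl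

/-- Number of the first child of the term or formula with number `c + 1`; the parameter is a pair
whose first component is `0` for formulas and `1` for terms. -/
def substLeft (x : ℕ × ℕ × ℕ) : ℕ :=
  if x.2.1 = 0 then
    if x.1.unpair.1 = 3 then x.1.unpair.2 else x.1.unpair.2.unpair.1
  else (x.1.unpair.2.unpair.2 - 1).unpair.1

/-- Number of the second child of the term or formula with number `c + 1`. -/
def substRight (x : ℕ × ℕ × ℕ) : ℕ :=
  if x.2.1 = 0 then x.1.unpair.2.unpair.2
  else ((x.1.unpair.2.unpair.2 - 1).unpair.2 - 1).unpair.1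

/-- The parameter for the children. -/
def substParam (x : ℕ × ℕ × ℕ) : ℕ × ℕ :=
  (if x.1.unpair.1 = 0 then 1 else x.2.1, x.2.2)

/-- The number of the result of the substitution, given those for the children. -/
def substComb (x : (ℕ × ℕ × ℕ) × ℕ × ℕ) : ℕ :=
  if x.1.2.1 = 0 then
    if x.1.1.unpair.1 = 3 then allCode x.2.1
    else Nat.pair x.1.1.unpair.1 (Nat.pair x.2.1 x.2.2) + 1
  else if x.1.1.unpair.1 = 0 then boundCode x.1.2.2
  else if x.1.1.unpair.1 = 1 then boundCode (x.1.2.2 + 1 + x.1.1.unpair.2)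
  else funcCode x.1.1.unpair.2.unpair.1
    (if x.1.1.unpair.2.unpair.2 = 0 then []
      else if (x.1.1.unpair.2.unpair.2 - 1).unpair.2 = 0 then [x.2.1] else [x.2.1, x.2.2])

theorem substLeft_le (x : ℕ × ℕ × ℕ) : substLeft x ≤ x.1 := by
  have h1 := Nat.unpair_right_le x.1
  have h2 := Nat.unpair_left_le x.1.unpair.2
  have h3 := Nat.unpair_right_le x.1.unpair.2
  have h4 := Nat.unpair_left_le (x.1.unpair.2.unpair.2 - 1)
  unfold substLeft
  split_ifs <;> omega

theorem substRight_le (x : ℕ × ℕ × ℕ) : substRight x ≤ x.1 := by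
  have h1 := Nat.unpair_right_le x.1
  have h3 := Nat.unpair_right_le x.1.unpair.2
  have h4 := Nat.unpair_right_le (x.1.unpair.2.unpair.2 - 1)
  have h5 := Nat.unpair_left_le ((x.1.unpair.2.unpair.2 - 1).unpair.2 - 1)
  unfold substRight
  split_ifs <;> omega

/-- Substitution, on Gödel numbers, of the bound variable `z_n` for the only free variable of a term
or formula, together with a shift of the bound variables by `n + 1`. -/
def substCode : ℕ → ℕ × ℕ → ℕ :=
  treeRec (fun _ => 0) substLeft substRight substParam (fun x => substParam x.1) substComb
    substLeft_le substRight_le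

theorem substCode_succ (c : ℕ) (a : ℕ × ℕ) : substCode (c + 1) a =
    substComb ((c, a), substCode (substLeft (c, a)) (substParam (c, a)),
      substCode (substRight (c, a)) (substParam (c, a))) := by
  simp only [substCode]
  rw [treeRec]

theorem computable_substCode : Computable₂ substCode := by
  have u1 : Primrec fun n : ℕ => n.unpair.1 := Primrec.fst.comp Primrec.unpair
  have u2 : Primrec fun n : ℕ => n.unpair.2 := Primrec.snd.comp Primrec.unpair
  have mode : Primrec fun x : ℕ × ℕ × ℕ => x.2.1 := Primrec.fst.comp Primrec.snd
  have lvl : Primrec fun x : ℕ × ℕ × ℕ => x.2.2 := Primrec.snd.comp Primrec.snd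
  have tag : Primrec fun x : ℕ × ℕ × ℕ => x.1.unpair.1 := u1.comp Primrec.fst
  have y : Primrec fun x : ℕ × ℕ × ℕ => x.1.unpair.2 := u2.comp Primrec.fst
  have y1 := u1.comp y
  have y2 := u2.comp y
  have eq0 : ∀ {β : Type} [Primcodable β] {f : β → ℕ} (k : ℕ), Primrec f →
      PrimrecPred fun b => f b = k := fun k hf => Primrec.eq.comp hf (Primrec.const k)
  have hparam : Primrec substParam :=
    (Primrec.ite (eq0 0 tag) (Primrec.const 1) mode).pair lvl
  have hleft : Primrec substLeft :=
    Primrec.ite (eq0 0 mode) (Primrec.ite (eq0 3 tag) y y1) (u1.comp (Primrec.pred.comp y2))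
  have hright : Primrec substRight :=
    Primrec.ite (eq0 0 mode) y2
      (u1.comp (Primrec.pred.comp (u2.comp (Primrec.pred.comp y2))))
  have a : Primrec fun x : (ℕ × ℕ × ℕ) × ℕ × ℕ => x.1 := Primrec.fst
  have u : Primrec fun x : (ℕ × ℕ × ℕ) × ℕ × ℕ => x.2.1 := Primrec.fst.comp Primrec.snd
  have v : Primrec fun x : (ℕ × ℕ × ℕ) × ℕ × ℕ => x.2.2 := Primrec.snd.comp Primrec.snd
  have hcomb : Primrec substComb := by
    refine Primrec.ite (eq0 0 (mode.comp a)) (Primrec.ite (eq0 3 (tag.comp a))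
      (primrec_allCode.comp u)
      (Primrec.succ.comp (Primrec₂.natPair.comp (tag.comp a) (Primrec₂.natPair.comp u v))))
      (Primrec.ite (eq0 0 (tag.comp a)) (primrec_boundCode.comp (lvl.comp a))
        (Primrec.ite (eq0 1 (tag.comp a))
          (primrec_boundCode.comp (Primrec.nat_add.comp (Primrec.succ.comp (lvl.comp a))
            (y.comp a)))
          (primrec_funcCode.comp (y1.comp a) (Primrec.ite (eq0 0 (y2.comp a)) (Primrec.const [])
            (Primrec.ite (eq0 0 (u2.comp (Primrec.pred.comp (y2.comp a))))
              (Primrec.list_cons.comp u (Primrec.const []))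
              (Primrec.list_cons.comp u (Primrec.list_cons.comp v (Primrec.const []))))))))
  exact computable_treeRec (Computable.const 0) hleft.to_comp hright.to_comp hparam.to_comp
    (hparam.comp Primrec.fst).to_comp hcomb.to_comp

/-- The relabelling of the only free variable as the bound variable `z_n`. -/
abbrev lastLabel (m n : ℕ) : Fin 1 → Fin m ⊕ Fin (n + 1) := fun _ => Sum.inr (Fin.last n)

theorem substCode_term {m n k : ℕ} (t : Language.ring.Term (Fin 1 ⊕ Fin k)) :
    substCode (termCode ringSymbCode t) (1, n) =
      termCode ringSymbCode
        (t.relabel (BoundedFormula.relabelAux (lastLabel m n) k)) := by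
  induction t with
  | var x =>
    rcases x with i | j
    · rw [termCode, substCode_succ]
      simp [substComb, Term.relabel, BoundedFormula.relabelAux, termCode, boundCode]
    · rw [termCode, substCode_succ]
      simp [substComb, Term.relabel, BoundedFormula.relabelAux, termCode, boundCode]
  | @func l s ts ih =>
    rw [termCode, substCode_succ, Term.relabel, termCode]
    -- Ring symbols have arity at most two, and `Encodable.encode (a :: l)` is `Nat.pair a
    -- (Encodable.encode l) + 1`; the two children of the recursion are therefore all the arguments.
    cases s <;>
      simp [substComb, substLeft, substRight, substParam, funcCode, List.ofFn_succ,
        Encodable.encode_list_cons, ← ih]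

theorem substCode_formula {m n k : ℕ} (θ : Language.ring.BoundedFormula (Fin 1) k) :
    substCode (formulaCode ringSymbCode ringRelCode θ) (0, n) =
      formulaCode ringSymbCode ringRelCode
        (θ.relabel (lastLabel m n)) := by
  induction θ with
  | falsum => rw [formulaCode, substCode, treeRec]; rfl
  | @equal k t₁ t₂ =>
    rw [formulaCode, substCode_succ]
    have h₁ := substCode_term (m := m) (n := n) t₁
    have h₂ := substCode_term (m := m) (n := n) t₂
    simp [substComb, substLeft, substRight, substParam, h₁, h₂, BoundedFormula.relabel,
      BoundedFormula.mapTermRel, formulaCode]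
  | rel R => exact R.elim
  | imp θ₁ θ₂ ih₁ ih₂ =>
    rw [BoundedFormula.relabel_imp, formulaCode_imp, formulaCode_imp, ← ih₁, ← ih₂, impCode,
      substCode_succ]
    simp [substComb, substLeft, substRight, substParam, impCode]
  | all θ ih =>
    rw [BoundedFormula.relabel_all, formulaCode_all, formulaCode_all, ← ih, allCode,
      substCode_succ]
    simp [substComb, substLeft, substParam, allCode]

end Substitution

/-! ### Cells: conjunctions of the members of a list or their negations. -/

section Signs

variable {γ δ : Type*}

/-- All conjunctions which contain every member of a list or its negation. -/
def signs (and : γ → γ → γ) (neg : γ → γ) (top : γ) : List γ → List γ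
  | [] => [top]
  | a :: l => (signs and neg top l).map (and a) ++ (signs and neg top l).map (and (neg a))

variable {and : γ → γ → γ} {neg : γ → γ} {top : γ} {and' : δ → δ → δ} {neg' : δ → δ} {top' : δ}

theorem length_signs (l : List γ) : (signs and neg top l).length = 2 ^ l.length := by
  induction l with
  | nil => rfl
  | cons a l ih => simp [signs, ih, pow_succ, mul_two]

/-- One generic `signs` serves formulas, terms, idempotents, truth values and Gödel numbers;
compatibility with homomorphisms makes their `j`-th cells correspond. -/
theorem map_signs {g : γ → δ} (hand : ∀ a b, g (and a b) = and' (g a) (g b))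
    (hneg : ∀ a, g (neg a) = neg' (g a)) (htop : g top = top') (l : List γ) :
    (signs and neg top l).map g = signs and' neg' top' (l.map g) := by
  induction l with
  | nil => simp [signs, htop]
  | cons a l ih =>
    simp only [signs, List.map_cons, List.map_append, ← ih, List.map_map, ← hneg]
    congr 1 <;> exact List.map_congr_left fun b _ => hand _ b

theorem getD_signs_map {g : γ → δ} (hand : ∀ a b, g (and a b) = and' (g a) (g b))
    (hneg : ∀ a, g (neg a) = neg' (g a)) (htop : g top = top') (l : List γ) (j : ℕ) :
    (signs and' neg' top' (l.map g)).getD j top' = g ((signs and neg top l).getD j top) := by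
  rw [← map_signs hand hneg htop, ← htop, List.getD_map]

theorem getD_map_of_lt (g : γ → δ) (l : List γ) {j : ℕ} (hj : j < l.length) (d : γ) (d' : δ) :
    (l.map g).getD j d' = g (l.getD j d) := by
  rw [List.getD_eq_getElem _ _ hj, List.getD_eq_getElem _ _ (by simpa using hj), List.getElem_map]

theorem forall_mem_zip_iff {R : γ → δ → Prop} {l : List γ} {l' : List δ} (h : l.length = l'.length)
    (d : γ) (d' : δ) : (∀ p ∈ l.zip l', R p.1 p.2) ↔
      ∀ j < l.length, R (l.getD j d) (l'.getD j d') := by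
  constructor
  · intro H j hj
    rw [List.getD_eq_getElem _ _ hj, List.getD_eq_getElem _ _ (h ▸ hj)]
    refine H (l[j], l'[j]) (List.mem_iff_getElem.2 ⟨j, by simpa [← h] using hj, by simp⟩)
  · intro H p hp
    obtain ⟨j, hj, rfl⟩ := List.mem_iff_getElem.1 hp
    have hj' : j < l.length := by
      simp only [List.length_zip, ← h, min_self] at hj
      exact hj
    have := H j hj'
    rw [List.getD_eq_getElem _ _ hj', List.getD_eq_getElem _ _ (h ▸ hj')] at this
    simpa using this

/-- Among the cells of the truth values `b` exactly one holds, so all conditions but one are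
vacuous, and that one asks for a `w` with truth pattern `b`. -/
theorem forall_signs_zip_iff {W : Type*} (P : List (W → Prop)) (b : List Prop)
    (h : P.length = b.length) (Q : W → Prop) :
    (∀ p ∈ (signs And Not True b).zip
        (signs (fun p q w => p w ∧ q w) (fun p w => ¬ p w) (fun _ => True) P),
      p.1 → ∃ w, Q w ∧ p.2 w) ↔ ∃ w, Q w ∧ ∀ p ∈ P.zip b, p.1 w ↔ p.2 := by
  induction P generalizing b Q with
  | nil =>
    obtain rfl := List.length_eq_zero_iff.1 h.symm
    simp [signs]
  | cons p P ih =>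
    obtain ⟨c, b, rfl⟩ := List.exists_cons_of_length_eq_add_one h.symm
    have h' : P.length = b.length := by simpa using h
    rw [signs, signs, List.zip_append (by simp [length_signs, h']), List.zip_map, List.zip_map]
    have key := fun Q' => ih b h' Q'
    simp only [List.mem_append, List.mem_map, or_imp, forall_and, forall_exists_index, and_imp,
      forall_apply_eq_imp_iff₂, Prod.map_fst, Prod.map_snd, List.zip_cons_cons,
      List.forall_mem_cons] at key ⊢
    -- The value of `c` makes one half of the list vacuous; in the other half the condition on `p`
    -- is moved into `Q`.
    by_cases hc : c
    · simp only [hc, true_imp_iff, not_true_eq_false, false_imp_iff, implies_true, and_true, iff_true,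
        ← and_assoc]
      exact key fun w => Q w ∧ p w
    · simp only [hc, false_imp_iff, implies_true, true_and, not_false_eq_true, true_imp_iff, iff_false,
        ← and_assoc]
      exact key fun w => Q w ∧ ¬ p w

theorem forall_signs_getD_iff {W : Type*} (P : List (W → Prop)) (b : List Prop)
    (h : P.length = b.length) (Q : W → Prop) :
    (∀ j < 2 ^ P.length, (signs And Not True b).getD j True → ∃ w, Q w ∧
      (signs (fun p q w => p w ∧ q w) (fun p w => ¬ p w) (fun _ => True) P).getD j
        (fun _ => True) w) ↔
      ∃ w, Q w ∧ ∀ i < P.length, P.getD i (fun _ => True) w ↔ b.getD i True := by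
  have h₁ := forall_mem_zip_iff (R := fun (b : Prop) (p : W → Prop) => b → ∃ w, Q w ∧ p w)
    (l := signs And Not True b)
    (l' := signs (fun p q w => p w ∧ q w) (fun p w => ¬ p w) (fun _ => True) P)
    (by simp [length_signs, h]) True (fun _ => True)
  rw [length_signs, ← h] at h₁
  rw [← h₁, forall_signs_zip_iff P b h Q]
  refine exists_congr fun w => and_congr_right fun _ => ?_
  exact forall_mem_zip_iff (R := fun (p : W → Prop) (b : Prop) => p w ↔ b) h _ _

end Signs

/-! ### Terms and formulas over idempotents, with their Gödel numbers. -/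

section BooleanTerms

variable {β : Type} {R : Type u} [CommRing R]

/-- The structure on the idempotents of `R` in which `Fin` means finite support. -/
@[reducible]
def idemStructure (R : Type u) [CommRing R] : boolFin.Structure (Idem R) :=
  boolFinStructure (Idem R) (finSupp R)

attribute [local instance] idemStructure

/-- The numbering of the function symbols of the language of Boolean algebras. -/
def boolSymbCode : ∀ l, boolFin.Functions l → ℕ := boolFuncCode

/-- The numbering of the relation symbols of the enriched language of Boolean algebras. -/
def boolPredCode : ∀ l, boolFin.Relations l → ℕ := boolRelCode

/-- The Gödel number of a meet. -/
def infCode (s t : ℕ) : ℕ := funcCode 1 [s, t]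

/-- The Gödel number of a complement. -/
def complCode (t : ℕ) : ℕ := funcCode 2 [t]

/-- The Gödel number of the term `0`. -/
def botCode : ℕ := funcCode 3 []

/-- The Gödel number of the term `1`. -/
def topCode : ℕ := funcCode 4 []

/-- The meet of two terms. -/
def infTerm (s t : boolFin.Term β) : boolFin.Term β :=
  .func (BoolFunc.inf : boolFin.Functions 2) ![s, t]

/-- The complement of a term. -/
def complTerm (t : boolFin.Term β) : boolFin.Term β :=
  .func (BoolFunc.compl : boolFin.Functions 1) ![t]

/-- The term `0`. -/
def botTerm : boolFin.Term β := .func (BoolFunc.bot : boolFin.Functions 0) ![]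

/-- The term `1`. -/
def topTerm : boolFin.Term β := .func (BoolFunc.top : boolFin.Functions 0) ![]

theorem realize_infTerm (s t : boolFin.Term β) (v : β → Idem R) :
    (infTerm s t).realize v = s.realize v ⊓ t.realize v := rfl

theorem realize_complTerm (t : boolFin.Term β) (v : β → Idem R) :
    (complTerm t).realize v = (t.realize v)ᶜ := rfl

theorem realize_botTerm (v : β → Idem R) : (botTerm : boolFin.Term β).realize v = ⊥ := rfl

theorem realize_topTerm (v : β → Idem R) : (topTerm : boolFin.Term β).realize v = ⊤ := rfl

variable {K N : ℕ}

theorem termCode_infTerm (s t : boolFin.Term (Fin K ⊕ Fin N)) : termCode boolSymbCode (infTerm s t) =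
    infCode (termCode boolSymbCode s) (termCode boolSymbCode t) := by
  simp [infTerm, infCode, termCode, funcCode, List.ofFn_succ]
  rfl

theorem termCode_complTerm (t : boolFin.Term (Fin K ⊕ Fin N)) : termCode boolSymbCode (complTerm t) =
    complCode (termCode boolSymbCode t) := by
  simp [complTerm, complCode, termCode, funcCode, List.ofFn_succ]
  rfl

theorem termCode_botTerm : termCode boolSymbCode (botTerm : boolFin.Term (Fin K ⊕ Fin N)) =
    botCode := rfl

theorem termCode_topTerm : termCode boolSymbCode (topTerm : boolFin.Term (Fin K ⊕ Fin N)) =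
    topCode := rfl

/-- The bound variable `z_j` (or `1` if it is not in scope). -/
def boundTerm (K N j : ℕ) : boolFin.Term (Fin K ⊕ Fin N) :=
  if h : j < N then .var (.inr ⟨j, h⟩) else topTerm

theorem termCode_boundTerm {j : ℕ} (h : j < N) :
    termCode boolSymbCode (boundTerm K N j) = boundCode j := by
  rw [boundTerm, dif_pos h]
  rfl

theorem realize_boundTerm {j : ℕ} (h : j < N) (v : Fin K → Idem R) (env : ℕ → Idem R) :
    (boundTerm K N j).realize (Sum.elim v fun i : Fin N => env i) = env j := by
  rw [boundTerm, dif_pos h]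
  rfl

/-- The Gödel number of an equation. -/
def eqCode (s t : ℕ) : ℕ := Nat.pair 0 (Nat.pair s t) + 1

theorem formulaCode_equal (s t : boolFin.Term (Fin K ⊕ Fin N)) :
    formulaCode boolSymbCode boolPredCode (.equal s t) =
      eqCode (termCode boolSymbCode s) (termCode boolSymbCode t) := rfl

/-- The formula `Fin(t)`. -/
def finFormula (t : boolFin.Term (Fin K ⊕ Fin N)) : boolFin.BoundedFormula (Fin K) N :=
  .rel (BoolRel.fin : boolFin.Relations 1) ![t]

/-- The Gödel number of `Fin(t)`. -/
def finCode (t : ℕ) : ℕ := Nat.pair 1 (Nat.pair 0 (Encodable.encode [t])) + 1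

theorem formulaCode_finFormula (t : boolFin.Term (Fin K ⊕ Fin N)) :
    formulaCode boolSymbCode boolPredCode (finFormula t) = finCode (termCode boolSymbCode t) := by
  simp [finFormula, formulaCode, finCode, List.ofFn_succ]
  rfl

theorem realize_finFormula (t : boolFin.Term (Fin K ⊕ Fin N)) (v : Fin K → Idem R)
    (xs : Fin N → Idem R) :
    (finFormula t).Realize v xs ↔ t.realize (Sum.elim v xs) ∈ finSupp R := Iff.rfl

theorem formulaCode_foldr_imp (l : List (boolFin.BoundedFormula (Fin K) N))
    (ψ : boolFin.BoundedFormula (Fin K) N) :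
    formulaCode boolSymbCode boolPredCode (l.foldr BoundedFormula.imp ψ) =
      (l.map (formulaCode boolSymbCode boolPredCode)).foldr impCode
        (formulaCode boolSymbCode boolPredCode ψ) := by
  induction l with
  | nil => rfl
  | cons θ l ih => simp [← ih, formulaCode_imp]

theorem fin_snoc_env {B : Type*} (env : ℕ → B) (n : ℕ) :
    (fun i : Fin (n + 1) => env i) = Fin.snoc (fun i : Fin n => env i) (env n) := by
  ext1 i
  refine Fin.lastCases ?_ (fun i => ?_) i <;> simp

/-- Valuations are restrictions of total assignments `ℕ → Idem R`, so a block of quantifiers ranges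
over the assignments that agree below `n`. -/
theorem exists_iterate_all {n : ℕ} (k : ℕ) (ψ : boolFin.BoundedFormula (Fin K) (n + k)) :
    ∃ ψ' : boolFin.BoundedFormula (Fin K) n, formulaCode boolSymbCode boolPredCode ψ' =
        allCode^[k] (formulaCode boolSymbCode boolPredCode ψ) ∧
      ∀ (R : Type u) [CommRing R] (v : Fin K → Idem R) (env : ℕ → Idem R),
        ψ'.Realize v (fun i => env i) ↔
          ∀ env' : ℕ → Idem R, (∀ j < n, env' j = env j) → ψ.Realize v fun i => env' i := by
  induction k with
  | zero =>
    refine ⟨ψ, rfl, fun R _ v env => ⟨fun h env' he => ?_, fun h => h env fun _ _ => rfl⟩⟩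
    have e : (fun i : Fin n => env i) = fun i : Fin n => env' i := funext fun i => (he i i.2).symm
    rw [e] at h
    exact h
  | succ k ih =>
    obtain ⟨ψ', hc, H⟩ := ih (BoundedFormula.all ψ)
    refine ⟨ψ', ?_, fun R _ v env => ?_⟩
    · rw [hc, formulaCode_all, Function.iterate_succ_apply]
    · rw [H]
      constructor
      · intro h env' he
        exact (iff_of_eq (congrArg (ψ.Realize v) (fin_snoc_env env' (n + k)))).2
          (h env' he (env' (n + k)))
      · intro h env' he b
        have := h (Function.update env' (n + k) b) fun j hj => by
          rw [Function.update_of_ne (by omega), he j hj]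
        have e := fin_snoc_env (Function.update env' (n + k) b) (n + k)
        rw [Function.update_self, show (fun i : Fin (n + k) => Function.update env' (n + k) b i) =
          fun i : Fin (n + k) => env' i from
            funext fun i => Function.update_of_ne i.2.ne _ _] at e
        exact (iff_of_eq (congrArg (ψ.Realize v) e)).1 this

end BooleanTerms

/-! ### Blocks of quantifiers restricted by cell conditions. -/

section Conditions

attribute [local instance] idemStructure

variable {K : ℕ}

/-- The Gödel number of the `j`-th Boolean combination of the variables `z_n, …, z_{n+k-1}`. -/
def cellCode (n k j : ℕ) : ℕ :=
  (signs infCode complCode topCode ((List.range k).map fun i => boundCode (n + i))).getD j topCode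

/-- The Gödel number of the translation of a quantifier over the ring as a block of `k` quantifiers
over idempotents `z_n, …`, restricted by conditions whose parameters are `z_o, …`. -/
def blockCode (o n k ψ : ℕ) : ℕ :=
  allCode^[k] (((List.range (2 ^ k)).map (fun j =>
      eqCode (infCode (cellCode n k j) (complCode (boundCode (o + j)))) botCode) ++
    (List.range (2 ^ k)).map (fun j =>
      finCode (infCode (cellCode n k j) (complCode (boundCode (o + 2 ^ k + j)))))).foldr impCode ψ)

/-- The first `2 ^ k` parameters from `z_o` on bound the cells of the new variables exactly, the
next `2 ^ k` up to finite support; `hn` keeps all of them below the new variables, so that `env'`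
agrees with `env` on them. -/
theorem exists_block {o n k : ℕ} (hn : o + (2 ^ k + 2 ^ k) ≤ n)
    (ψ : boolFin.BoundedFormula (Fin K) (n + k)) :
    ∃ ψ' : boolFin.BoundedFormula (Fin K) n, formulaCode boolSymbCode boolPredCode ψ' =
        blockCode o n k (formulaCode boolSymbCode boolPredCode ψ) ∧
      ∀ (R : Type u) [CommRing R] (v : Fin K → Idem R) (env : ℕ → Idem R),
        ψ'.Realize v (fun i => env i) ↔
          ∀ env' : ℕ → Idem R, (∀ j < n, env' j = env j) →
            (∀ j < 2 ^ k, (signs (· ⊓ ·) (·ᶜ) ⊤ ((List.range k).map fun i => env' (n + i))).getD j ⊤ ⊓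
              (env (o + j))ᶜ = ⊥) →
            (∀ j < 2 ^ k, (signs (· ⊓ ·) (·ᶜ) ⊤ ((List.range k).map fun i => env' (n + i))).getD j ⊤ ⊓
              (env (o + 2 ^ k + j))ᶜ ∈ finSupp R) →
            ψ.Realize v fun i => env' i := by
  let T : List (boolFin.Term (Fin K ⊕ Fin (n + k))) :=
    signs infTerm complTerm topTerm ((List.range k).map fun i => boundTerm K (n + k) (n + i))
  have hT : ∀ j, termCode boolSymbCode (T.getD j topTerm) = cellCode n k j := by
    intro j
    rw [cellCode, ← getD_signs_map termCode_infTerm termCode_complTerm termCode_topTerm,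
      List.map_map]
    congr 2
    exact List.map_congr_left fun i hi => termCode_boundTerm (by
      have := List.mem_range.1 hi
      omega)
  have hT' : ∀ {R : Type u} [CommRing R] (v : Fin K → Idem R) (env : ℕ → Idem R) (j : ℕ),
      (T.getD j topTerm).realize (Sum.elim v fun i : Fin (n + k) => env i) =
        (signs (· ⊓ ·) (·ᶜ) ⊤ ((List.range k).map fun i => env (n + i))).getD j ⊤ := by
    intro R _ v env j
    have := getD_signs_map
      (g := fun t => Term.realize (Sum.elim v fun i : Fin (n + k) => env i) t)
      (and := infTerm) (neg := complTerm) (top := topTerm) (and' := (· ⊓ ·)) (neg' := (·ᶜ))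
      (fun s t => realize_infTerm s t _) (fun t => realize_complTerm t _) (realize_topTerm _)
      ((List.range k).map fun i => boundTerm K (n + k) (n + i)) j
    rw [← this, List.map_map]
    congr 2
    exact List.map_congr_left fun i hi => realize_boundTerm (j := n + i) (by
      have := List.mem_range.1 hi
      omega) v env
  obtain ⟨ψ', hc, H⟩ := exists_iterate_all.{u} k
    (((List.range (2 ^ k)).map (fun j => BoundedFormula.equal
        (infTerm (T.getD j topTerm) (complTerm (boundTerm K (n + k) (o + j)))) botTerm) ++
      (List.range (2 ^ k)).map (fun j => finFormula
        (infTerm (T.getD j topTerm) (complTerm (boundTerm K (n + k) (o + 2 ^ k + j)))))).foldr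
      BoundedFormula.imp ψ)
  refine ⟨ψ', ?_, fun R _ v env => ?_⟩
  · rw [hc, formulaCode_foldr_imp, List.map_append, List.map_map, List.map_map]
    have e₁ : ∀ j ∈ List.range (2 ^ k), (formulaCode boolSymbCode boolPredCode ∘ fun j =>
        BoundedFormula.equal
          (infTerm (T.getD j topTerm) (complTerm (boundTerm K (n + k) (o + j)))) botTerm) j =
        eqCode (infCode (cellCode n k j) (complCode (boundCode (o + j)))) botCode := by
      intro j hj
      have := List.mem_range.1 hj
      simp only [Function.comp, formulaCode_equal, termCode_infTerm, termCode_complTerm, hT,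
        termCode_botTerm]
      rw [termCode_boundTerm (by omega)]
    have e₂ : ∀ j ∈ List.range (2 ^ k), (formulaCode boolSymbCode boolPredCode ∘ fun j =>
        finFormula
          (infTerm (T.getD j topTerm) (complTerm (boundTerm K (n + k) (o + 2 ^ k + j))))) j =
        finCode (infCode (cellCode n k j) (complCode (boundCode (o + 2 ^ k + j)))) := by
      intro j hj
      have := List.mem_range.1 hj
      simp only [Function.comp, formulaCode_finFormula, termCode_infTerm, termCode_complTerm, hT]
      rw [termCode_boundTerm (by omega)]
    rw [List.map_congr_left e₁, List.map_congr_left e₂, blockCode]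
  · rw [H]
    refine forall_congr' fun env' => imp_congr_right fun he => ?_
    rw [BoundedFormula.realize_foldr_imp]
    simp only [List.mem_append, List.mem_map, List.mem_range, or_imp, forall_and,
      forall_exists_index, and_imp, forall_apply_eq_imp_iff₂]
    have h₁ : ∀ j < 2 ^ k, (BoundedFormula.equal
        (infTerm (T.getD j topTerm) (complTerm (boundTerm K (n + k) (o + j)))) botTerm).Realize v
          (fun i => env' i) ↔
        (signs (· ⊓ ·) (·ᶜ) ⊤ ((List.range k).map fun i => env' (n + i))).getD j ⊤ ⊓
          (env (o + j))ᶜ = ⊥ := by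
      intro j hj
      refine Iff.trans (BoundedFormula.realize_bdEqual _ _) ?_
      rw [realize_infTerm, realize_complTerm, hT', realize_boundTerm (by omega), realize_botTerm,
        he _ (by omega)]
    have h₂ : ∀ j < 2 ^ k, (finFormula
        (infTerm (T.getD j topTerm) (complTerm (boundTerm K (n + k) (o + 2 ^ k + j))))).Realize v
          (fun i => env' i) ↔
        (signs (· ⊓ ·) (·ᶜ) ⊤ ((List.range k).map fun i => env' (n + i))).getD j ⊤ ⊓
          (env (o + 2 ^ k + j))ᶜ ∈ finSupp R := by
      intro j hj
      rw [realize_finFormula, realize_infTerm, realize_complTerm, hT',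
        realize_boundTerm (by omega), he _ (by omega)]
    exact ⟨fun h c₁ c₂ => h (fun j hj => (h₁ j hj).2 (c₁ j hj)) fun j hj => (h₂ j hj).2 (c₂ j hj),
      fun h c₁ c₂ => h (fun j hj => (h₁ j hj).1 (c₁ j hj)) fun j hj => (h₂ j hj).1 (c₂ j hj)⟩

end Conditions

/-! ### A ring quantifier as a block of quantifiers over idempotents. -/

section QuantifierBlocks

variable {φ : Language.ring.Formula (Fin 1)} {R : Type u} [CommRing R]

/-- All conjunctions of members of a list of formulas and negations of the other members. -/
def signFormulas {α : Type*} {n : ℕ} (l : List (Language.ring.BoundedFormula α n)) :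
    List (Language.ring.BoundedFormula α n) :=
  signs (· ⊓ ·) BoundedFormula.not ⊤ l

theorem length_signFormulas {α : Type*} {n : ℕ} (l : List (Language.ring.BoundedFormula α n)) :
    (signFormulas l).length = 2 ^ l.length := length_signs l

/-- All meets of members of a list and complements of the other members. -/
def signMeets {B : Type*} [BooleanAlgebra B] (l : List B) : List B :=
  signs (· ⊓ ·) (·ᶜ) ⊤ l

/-- An atom lies below exactly one cell of `z`, so the conditions on all cells amount to one `w`
whose truth pattern is the membership pattern of the atom. -/
theorem forall_signMeets_iff {α : Type*} {n : ℕ} (l : List (Language.ring.BoundedFormula α (n + 1)))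
    (z : List (Idem R)) (hz : l.length = z.length) (a : Atoms R) {A : Type*} [CommRing A] (v : α → A)
    (xs : Fin n → A) (Q : A → Prop) :
    (∀ j < 2 ^ l.length, a ∈ atomsBelow ((signMeets z).getD j ⊤) →
      ∃ w, Q w ∧ ((signFormulas l).getD j ⊤).Realize v (Fin.snoc xs w)) ↔
    ∃ w, Q w ∧ ∀ i < l.length,
      (l.getD i ⊤).Realize v (Fin.snoc xs w) ↔ a ∈ atomsBelow (z.getD i ⊤) := by
  have key := forall_signs_getD_iff (l.map fun θ w => θ.Realize v (Fin.snoc xs w))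
    (z.map fun y => a ∈ atomsBelow y) (by simpa using hz) Q
  have h₁ : ∀ j, (signs And Not True (z.map fun y => a ∈ atomsBelow y)).getD j True ↔
      a ∈ atomsBelow ((signMeets z).getD j ⊤) := fun j => iff_of_eq <|
    getD_signs_map (g := fun y : Idem R => a ∈ atomsBelow y)
      (fun x y => by rw [atomsBelow_inf]; rfl) (fun x => by rw [atomsBelow_compl]; rfl)
      (by simp) z j
  have h₂ : ∀ j w, (signs (fun (p q : A → Prop) w => p w ∧ q w) (fun p w => ¬ p w) (fun _ => True)
      (l.map fun θ w => θ.Realize v (Fin.snoc xs w))).getD j (fun _ => True) w ↔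
      ((signFormulas l).getD j ⊤).Realize v (Fin.snoc xs w) := fun j w => iff_of_eq <|
    congrFun (getD_signs_map
      (g := fun (θ : Language.ring.BoundedFormula α (n + 1)) w => θ.Realize v (Fin.snoc xs w))
      (and := (· ⊓ ·)) (neg := BoundedFormula.not) (top := ⊤)
      (fun x y => funext fun w => propext BoundedFormula.realize_inf)
      (fun x => funext fun w => propext BoundedFormula.realize_not)
      (funext fun w => propext BoundedFormula.realize_top) l j) w
  simp only [h₁, h₂, List.length_map] at key
  rw [key]
  refine exists_congr fun w => and_congr_right fun _ => forall₂_congr fun i hi => ?_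
  rw [getD_map_of_lt _ l hi ⊤, getD_map_of_lt _ z (hz ▸ hi) ⊤]

theorem SatisfiesAxioms.inf_compl_eq_bot_iff (h : SatisfiesAxioms φ R) {x y : Idem R} :
    x ⊓ yᶜ = ⊥ ↔ ∀ a, a ∈ atomsBelow x → a ∈ atomsBelow y := by
  rw [h.eq_bot_iff, atomsBelow_inf, atomsBelow_compl, ← Set.sdiff_eq, Set.sdiff_eq_empty]
  rfl

/-- The cut-out subset of atoms of a formula. -/
def satSet {m n : ℕ} (θ : Language.ring.BoundedFormula (Fin m) n) (f : Fin m → R) (xs : Fin n → R) :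
    Set (Atoms R) :=
  {a | θ.Realize (algebraMap R (Stalk a.1) ∘ f) (algebraMap R (Stalk a.1) ∘ xs)}

theorem mem_satSet_snoc {m n : ℕ} (θ : Language.ring.BoundedFormula (Fin m) (n + 1)) (f : Fin m → R)
    (xs : Fin n → R) (g : R) (a : Atoms R) : a ∈ satSet θ f (Fin.snoc xs g) ↔
      θ.Realize (algebraMap R (Stalk a.1) ∘ f)
        (Fin.snoc (algebraMap R (Stalk a.1) ∘ xs) (algebraMap R (Stalk a.1) g)) := by
  rw [satSet, Set.mem_ofPred_eq, comp_snoc]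

section Blocks

variable {m n : ℕ} {l : List (Language.ring.BoundedFormula (Fin m) (n + 1))} {z : List (Idem R)}
  {f : Fin m → R} {xs : Fin n → R} {k : ℕ} {Y D : ℕ → Idem R}

/-- Necessity of the cell conditions: the image of `g` is a witness at every atom, and lies in `φ`
at almost all of them. -/
theorem SatisfiesAxioms.inf_compl_of_realize (h : SatisfiesAxioms φ R)
    (hz : l.length = z.length) (hk : k = 2 ^ l.length)
    (hY : ∀ j < k, ∀ a, a ∈ atomsBelow (Y j) ↔ ∃ w : Stalk a.1,
      ((signFormulas l).getD j ⊤).Realize (algebraMap R (Stalk a.1) ∘ f)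
        (Fin.snoc (algebraMap R (Stalk a.1) ∘ xs) w))
    (hD : ∀ j < k, ∀ a, a ∈ atomsBelow (D j) ↔ ∃ w : Stalk a.1,
      φ.Realize (fun _ => w) ∧ ((signFormulas l).getD j ⊤).Realize (algebraMap R (Stalk a.1) ∘ f)
        (Fin.snoc (algebraMap R (Stalk a.1) ∘ xs) w))
    {g : R} (hg : ∀ i < l.length, atomsBelow (z.getD i ⊤) = satSet (l.getD i ⊤) f (Fin.snoc xs g)) :
    (∀ j < k, (signMeets z).getD j ⊤ ⊓ (Y j)ᶜ = ⊥) ∧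
      ∀ j < k, (signMeets z).getD j ⊤ ⊓ (D j)ᶜ ∈ finSupp R := by
  subst hk
  have hsat : ∀ (a : Atoms R), ∀ i < l.length, (l.getD i ⊤).Realize (algebraMap R (Stalk a.1) ∘ f)
      (Fin.snoc (algebraMap R (Stalk a.1) ∘ xs) (algebraMap R (Stalk a.1) g)) ↔
      a ∈ atomsBelow (z.getD i ⊤) := by
    intro a i hi
    rw [hg i hi, mem_satSet_snoc]
  refine ⟨fun j hj => ?_, fun j hj => ?_⟩
  · rw [h.inf_compl_eq_bot_iff]
    intro a ha
    obtain ⟨w, -, hw⟩ := (forall_signMeets_iff l z hz a _ _ fun _ => True).2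
      ⟨_, trivial, hsat a⟩ j hj ha
    exact (hY j hj a).2 ⟨w, hw⟩
  · rw [h.mem_finSupp_iff, atomsBelow_inf, atomsBelow_compl]
    refine (h.stalkFrame.finite_not g).subset fun a ha hn => ha.2 ?_
    exact (hD j hj a).2 ((forall_signMeets_iff l z hz a _ _ fun w => φ.Realize fun _ => w).2
      ⟨_, hn, hsat a⟩ j hj ha.1)

/-- Sufficiency: `c₁` gives local witnesses at all atoms, `c₂` gives witnesses in `φ` outside a
finite union of finite sets, and the witnesses are glued. -/
theorem SatisfiesAxioms.exists_realize_of_inf_compl (h : SatisfiesAxioms φ R)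
    (hz : l.length = z.length) (hk : k = 2 ^ l.length)
    (hY : ∀ j < k, ∀ a, a ∈ atomsBelow (Y j) ↔ ∃ w : Stalk a.1,
      ((signFormulas l).getD j ⊤).Realize (algebraMap R (Stalk a.1) ∘ f)
        (Fin.snoc (algebraMap R (Stalk a.1) ∘ xs) w))
    (hD : ∀ j < k, ∀ a, a ∈ atomsBelow (D j) ↔ ∃ w : Stalk a.1,
      φ.Realize (fun _ => w) ∧ ((signFormulas l).getD j ⊤).Realize (algebraMap R (Stalk a.1) ∘ f)
        (Fin.snoc (algebraMap R (Stalk a.1) ∘ xs) w))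
    (c₁ : ∀ j < k, (signMeets z).getD j ⊤ ⊓ (Y j)ᶜ = ⊥)
    (c₂ : ∀ j < k, (signMeets z).getD j ⊤ ⊓ (D j)ᶜ ∈ finSupp R) :
    ∃ g : R, ∀ i < l.length, atomsBelow (z.getD i ⊤) = satSet (l.getD i ⊤) f (Fin.snoc xs g) := by
  subst hk
  have h₁ : ∀ a : Atoms R, ∃ w : Stalk a.1, ∀ i : Fin l.length,
      (l.getD i ⊤).Realize (algebraMap R (Stalk a.1) ∘ f)
        (Fin.snoc (algebraMap R (Stalk a.1) ∘ xs) w) ↔ a ∈ atomsBelow (z.getD i ⊤) := by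
    intro a
    obtain ⟨w, -, hw⟩ := (forall_signMeets_iff l z hz a (algebraMap R (Stalk a.1) ∘ f)
      (algebraMap R (Stalk a.1) ∘ xs) fun _ => True).1 fun j hj ha =>
        ((hY j hj a).1 ((h.inf_compl_eq_bot_iff.1 (c₁ j hj)) a ha)).imp fun w hw => ⟨trivial, hw⟩
    exact ⟨w, fun i => hw i i.2⟩
  have h₂ : {a : Atoms R | ¬ ∃ w : Stalk a.1, φ.Realize (fun _ => w) ∧ ∀ i : Fin l.length,
      (l.getD i ⊤).Realize (algebraMap R (Stalk a.1) ∘ f)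
        (Fin.snoc (algebraMap R (Stalk a.1) ∘ xs) w) ↔ a ∈ atomsBelow (z.getD i ⊤)}.Finite := by
    have hfin : (⋃ j : Fin (2 ^ l.length),
        atomsBelow ((signMeets z).getD j ⊤ ⊓ (D j)ᶜ)).Finite :=
      Set.finite_iUnion fun j => h.mem_finSupp_iff.1 (c₂ j j.2)
    refine hfin.subset fun a ha => ?_
    by_contra hn
    refine ha ?_
    obtain ⟨w, hw, hw'⟩ := (forall_signMeets_iff l z hz a (algebraMap R (Stalk a.1) ∘ f)
      (algebraMap R (Stalk a.1) ∘ xs) fun w => φ.Realize fun _ => w).1 fun j hj haj => by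
        by_contra hc
        refine hn (Set.mem_iUnion.2 ⟨⟨j, hj⟩, ?_⟩)
        rw [atomsBelow_inf, atomsBelow_compl]
        exact ⟨haj, fun hm => hc ((hD j hj a).1 hm)⟩
    exact ⟨w, hw, fun i => hw' i i.2⟩
  obtain ⟨g, hg⟩ := h.stalkFrame.exists_forall_realize_iff (ι := Fin l.length)
    (fun i => l.getD i ⊤) f xs (fun i => atomsBelow (z.getD i ⊤))
    (fun i => Set.mem_range_self _) h₁ h₂
  refine ⟨g, fun i hi => ?_⟩
  ext a
  rw [mem_satSet_snoc]
  exact (hg a ⟨i, hi⟩).symm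

theorem SatisfiesAxioms.exists_atomsBelow_eq_satSet (h : SatisfiesAxioms φ R) {m n : ℕ}
    (θ : Language.ring.BoundedFormula (Fin m) n) (f : Fin m → R) (xs : Fin n → R) :
    ∃ x : Idem R, atomsBelow x = satSet θ f xs :=
  h.stalkFrame.setOf_realize_mem θ f xs

end Blocks

theorem SatisfiesAxioms.forall_block_iff (h : SatisfiesAxioms φ R) {m n : ℕ}
    (l : List (Language.ring.BoundedFormula (Fin m) (n + 1))) (f : Fin m → R) (xs : Fin n → R)
    {N k : ℕ} (hk : k = 2 ^ l.length) (env Y D : ℕ → Idem R)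
    (hY : ∀ j < k, ∀ a, a ∈ atomsBelow (Y j) ↔ ∃ w : Stalk a.1,
      ((signFormulas l).getD j ⊤).Realize (algebraMap R (Stalk a.1) ∘ f)
        (Fin.snoc (algebraMap R (Stalk a.1) ∘ xs) w))
    (hD : ∀ j < k, ∀ a, a ∈ atomsBelow (D j) ↔ ∃ w : Stalk a.1,
      φ.Realize (fun _ => w) ∧ ((signFormulas l).getD j ⊤).Realize (algebraMap R (Stalk a.1) ∘ f)
        (Fin.snoc (algebraMap R (Stalk a.1) ∘ xs) w))
    (P : (ℕ → Idem R) → Prop) (Q : R → Prop)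
    (hPQ : ∀ env' g, (∀ i < l.length, atomsBelow (env' (N + i)) =
      satSet (l.getD i ⊤) f (Fin.snoc xs g)) → (P env' ↔ Q g)) :
    (∀ env' : ℕ → Idem R, (∀ j < N, env' j = env j) →
      (∀ j < k, (signMeets ((List.range l.length).map fun i => env' (N + i))).getD j ⊤ ⊓
          (Y j)ᶜ = ⊥) →
      (∀ j < k, (signMeets ((List.range l.length).map fun i => env' (N + i))).getD j ⊤ ⊓
          (D j)ᶜ ∈ finSupp R) → P env') ↔ ∀ g, Q g := by
  have hlen : ∀ env' : ℕ → Idem R,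
      l.length = ((List.range l.length).map fun i => env' (N + i)).length := fun env' => by
    rw [List.length_map, List.length_range]
  have hget : ∀ (env' : ℕ → Idem R), ∀ i < l.length,
      ((List.range l.length).map fun i => env' (N + i)).getD i ⊤ = env' (N + i) := by
    intro env' i hi
    have hi' : i < (List.range l.length).length := by rwa [List.length_range]
    rw [getD_map_of_lt _ _ hi' 0, List.getD_eq_getElem _ _ hi', List.getElem_range]
  constructor
  · intro H g
    choose y hy using fun i => h.exists_atomsBelow_eq_satSet (l.getD i ⊤) f (Fin.snoc xs g)
    -- The new variables receive the Boolean values of the members of `l` at `g`.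
    let env' : ℕ → Idem R := fun j => if j < N then env j else y (j - N)
    have he : ∀ i, env' (N + i) = y i := fun i => by simp [env']
    obtain ⟨c₁, c₂⟩ := h.inf_compl_of_realize (hlen env') hk hY hD (g := g) fun i hi => by
      rw [hget env' i hi, he, hy]
    exact (hPQ env' g fun i _ => by rw [he, hy]).1 (H env' (fun j hj => if_pos hj) c₁ c₂)
  · intro H env' _ c₁ c₂
    obtain ⟨g, hg⟩ := h.exists_realize_of_inf_compl (hlen env') hk hY hD c₁ c₂
    exact (hPQ env' g fun i hi => by rw [← hg i hi, hget env' i hi]).2 (H g)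

end QuantifierBlocks

/-! ### The translation algorithm and its computability. -/

section Translation

theorem primrec_signs {α : Type} [Primcodable α] {and : α → α → α} {neg : α → α} {top : α}
    (hand : Primrec₂ and) (hneg : Primrec neg) : Primrec (signs and neg top) := by
  have h : Primrec fun l : List α => l.foldr
      (fun a s => s.map (and a) ++ s.map (and (neg a))) [top] := by
    have a : Primrec fun x : List α × α × List α => x.2.1 := Primrec.fst.comp Primrec.snd
    have s : Primrec fun x : List α × α × List α => x.2.2 := Primrec.snd.comp Primrec.snd
    refine Primrec.list_foldr (h := fun _ x => x.2.map (and x.1) ++ x.2.map (and (neg x.1)))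
      Primrec.id (Primrec.const _) (Primrec.list_append.comp
        (Primrec.list_map s ?_) (Primrec.list_map s ?_))
    · exact hand.comp (a.comp Primrec.fst) Primrec.snd
    · exact hand.comp (hneg.comp (a.comp Primrec.fst)) Primrec.snd
  refine h.of_eq fun l => ?_
  induction l with
  | nil => rfl
  | cons a l ih => rw [List.foldr_cons, ih, signs]

theorem primrec_two_pow : Primrec fun n : ℕ => 2 ^ n := by
  refine (Primrec.nat_iterate (h := fun _ m : ℕ => 2 * m) Primrec.id (Primrec.const 1)
    (Primrec.nat_mul.comp (Primrec.const 2) Primrec.snd)).of_eq fun n => ?_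
  induction n with
  | zero => rfl
  | succ n ih => rw [id, Function.iterate_succ_apply', ← id_eq n, ih, id, pow_succ, mul_comm]

theorem primrec_infCode : Primrec₂ infCode :=
  primrec_funcCode.comp (Primrec.const 1)
    (Primrec.list_cons.comp Primrec.fst (Primrec.list_cons.comp Primrec.snd (Primrec.const [])))

theorem primrec_complCode : Primrec complCode :=
  primrec_funcCode.comp (Primrec.const 2) (Primrec.list_cons.comp Primrec.id (Primrec.const []))

theorem primrec_eqCode : Primrec₂ eqCode :=
  Primrec.succ.comp (Primrec₂.natPair.comp (Primrec.const 0) Primrec₂.natPair)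

theorem primrec_finCode : Primrec finCode :=
  Primrec.succ.comp (Primrec₂.natPair.comp (Primrec.const 1) (Primrec₂.natPair.comp (Primrec.const 0)
    (Primrec.encode.comp (Primrec.list_cons.comp Primrec.id (Primrec.const [])))))

theorem primrec_cellCode : Primrec fun x : (ℕ × ℕ) × ℕ => cellCode x.1.1 x.1.2 x.2 := by
  refine (Primrec.list_getD topCode).comp ((primrec_signs primrec_infCode primrec_complCode).comp
    (Primrec.list_map (Primrec.list_range.comp (Primrec.snd.comp Primrec.fst)) ?_)) Primrec.snd
  exact primrec_boundCode.comp (Primrec.nat_add.comp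
    (Primrec.fst.comp (Primrec.fst.comp Primrec.fst)) Primrec.snd)

theorem primrec_iterate_allCode : Primrec₂ fun k c : ℕ => allCode^[k] c :=
  Primrec.nat_iterate (h := fun _ c => allCode c) Primrec.fst Primrec.snd
    (primrec_allCode.comp Primrec.snd)

theorem primrec_foldr_impCode : Primrec₂ fun (l : List ℕ) (c : ℕ) => l.foldr impCode c :=
  Primrec.list_foldr (h := fun _ x => impCode x.1 x.2) Primrec.fst Primrec.snd
    (primrec_impCode.comp (Primrec.fst.comp Primrec.snd) (Primrec.snd.comp Primrec.snd))

theorem primrec_blockCode {α : Type} [Primcodable α] {o n k ψ : α → ℕ} (ho : Primrec o)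
    (hn : Primrec n) (hk : Primrec k) (hψ : Primrec ψ) :
    Primrec fun x => blockCode (o x) (n x) (k x) (ψ x) := by
  have K := primrec_two_pow.comp hk
  have cell : Primrec fun x : α × ℕ => cellCode (n x.1) (k x.1) x.2 :=
    primrec_cellCode.comp (((hn.comp Primrec.fst).pair (hk.comp Primrec.fst)).pair Primrec.snd)
  refine primrec_iterate_allCode.comp hk (primrec_foldr_impCode.comp (Primrec.list_append.comp
    (Primrec.list_map (Primrec.list_range.comp K) ?_)
    (Primrec.list_map (Primrec.list_range.comp K) ?_)) hψ)
  · exact primrec_eqCode.comp (primrec_infCode.comp cell (primrec_complCode.comp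
      (primrec_boundCode.comp (Primrec.nat_add.comp (ho.comp Primrec.fst) Primrec.snd))))
        (Primrec.const botCode)
  · exact primrec_finCode.comp (primrec_infCode.comp cell (primrec_complCode.comp
      (primrec_boundCode.comp (Primrec.nat_add.comp (Primrec.nat_add.comp (ho.comp Primrec.fst)
        (K.comp Primrec.fst)) Primrec.snd))))

/-- The Gödel numbers of the formulas whose Boolean values are needed in order to translate a
quantifier, given the number of `φ` and those of the formulas needed for its scope. -/
def quantifierCodes (c : ℕ) (l : List ℕ) : List ℕ :=
  (signs andCode notCode (notCode 0) l).map exCode ++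
    (signs andCode notCode (notCode 0) l).map fun s => exCode (andCode c s)

theorem primrec_quantifierCodes : Primrec₂ quantifierCodes := by
  have s : Primrec fun x : ℕ × List ℕ => signs andCode notCode (notCode 0) x.2 :=
    (primrec_signs primrec_andCode primrec_notCode).comp Primrec.snd
  refine Primrec.list_append.comp (Primrec.list_map s ?_) (Primrec.list_map s ?_)
  · exact primrec_exCode.comp Primrec.snd
  · exact primrec_exCode.comp (primrec_andCode.comp (Primrec.fst.comp Primrec.fst) Primrec.snd)

/-- Number of the first immediate subformula of the formula with number `c + 1`. -/
def firstChild (c : ℕ) : ℕ := if c.unpair.1 = 3 then c.unpair.2 else c.unpair.2.unpair.1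

/-- Number of the last immediate subformula of the formula with number `c + 1`. -/
def lastChild (c : ℕ) : ℕ := if c.unpair.1 = 3 then c.unpair.2 else c.unpair.2.unpair.2

theorem firstChild_le (c : ℕ) : firstChild c ≤ c := by
  have h1 := Nat.unpair_right_le c
  have h2 := Nat.unpair_left_le c.unpair.2
  unfold firstChild
  split_ifs <;> omega

theorem lastChild_le (c : ℕ) : lastChild c ≤ c := by
  have h1 := Nat.unpair_right_le c
  have h2 := Nat.unpair_right_le c.unpair.2
  unfold lastChild
  split_ifs <;> omega

/-- Parameters of a translation: the number of `φ`, the number of bound ring variables in scope, the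
first idempotent variable assigned to the formula, and the first unused idempotent variable. -/
abbrev TransParam : Type := ℕ × ℕ × ℕ × ℕ

/-- The parameter for the first subformula. -/
def firstParam (x : ℕ × TransParam) : TransParam :=
  (x.2.1, if x.1.unpair.1 = 3 then x.2.2.1 + 1 else x.2.2.1, x.2.2.2)

/-- The parameter for the last subformula, given that `k` idempotent variables are assigned to the
first one. -/
def lastParam (x : ℕ × TransParam) (k : ℕ) : TransParam :=
  (x.2.1, if x.1.unpair.1 = 3 then (x.2.2.1 + 1, x.2.2.2.2, x.2.2.2.2 + k)
    else (x.2.2.1, x.2.2.2.1 + k, x.2.2.2.2))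

/-- The translation of a formula, given those of its immediate subformulas and, for a quantified
formula, the number `s` of `φ` at the quantified variable. -/
def transComb (x : ℕ × TransParam) (s : ℕ) (u v : List ℕ × ℕ) : List ℕ × ℕ :=
  if x.1.unpair.1 = 3 then
    (quantifierCodes s v.1, blockCode x.2.2.2.1 x.2.2.2.2 v.1.length v.2)
  else if x.1.unpair.1 = 2 then (u.1 ++ v.1, impCode u.2 v.2)
  else ([x.1 + 1], eqCode (boundCode x.2.2.2.1) topCode)

/-- The translation, on Gödel numbers, of ring formulas to formulas about idempotents. -/
def trans : ℕ → TransParam → List ℕ × ℕ :=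
  treeRec (fun _ => ([], 0)) (fun x => firstChild x.1) (fun x => lastChild x.1) firstParam
    (fun x => lastParam x.1 x.2.1.length)
    (fun x => transComb x.1 (substCode x.1.2.1 (0, x.1.2.2.1)) x.2.1 x.2.2)
    (fun x => firstChild_le x.1) (fun x => lastChild_le x.1)

theorem trans_zero (a : TransParam) : trans 0 a = ([], 0) := by
  rw [trans, treeRec]

theorem trans_succ (c : ℕ) (a : TransParam) : trans (c + 1) a =
    transComb (c, a) (substCode a.1 (0, a.2.1)) (trans (firstChild c) (firstParam (c, a)))
      (trans (lastChild c)
        (lastParam (c, a) (trans (firstChild c) (firstParam (c, a))).1.length)) := by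
  simp only [trans]
  rw [treeRec]

theorem primrec_unpair_eq (k : ℕ) : PrimrecPred fun c : ℕ => c.unpair.1 = k :=
  Primrec.eq.comp (Primrec.fst.comp Primrec.unpair) (Primrec.const k)

theorem primrec_transComb {α : Type} [Primcodable α] {x : α → ℕ × TransParam} {s : α → ℕ}
    {u v : α → List ℕ × ℕ} (hx : Primrec x) (hs : Primrec s) (hu : Primrec u) (hv : Primrec v) :
    Primrec fun a => transComb (x a) (s a) (u a) (v a) := by
  have c : Primrec fun a => (x a).1 := Primrec.fst.comp hx
  have oN : Primrec fun a => (x a).2.2.2 :=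
    Primrec.snd.comp (Primrec.snd.comp (Primrec.snd.comp hx))
  have o : Primrec fun a => (x a).2.2.2.1 := Primrec.fst.comp oN
  have N : Primrec fun a => (x a).2.2.2.2 := Primrec.snd.comp oN
  have v1 : Primrec fun a => (v a).1 := Primrec.fst.comp hv
  have v2 : Primrec fun a => (v a).2 := Primrec.snd.comp hv
  have len : Primrec fun a => (v a).1.length := Primrec.list_length.comp v1
  have hall := (primrec_quantifierCodes.comp hs v1).pair (primrec_blockCode o N len v2)
  have himp := (Primrec.list_append.comp (Primrec.fst.comp hu) v1).pair
    (primrec_impCode.comp (Primrec.snd.comp hu) v2)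
  have heq := (Primrec.list_cons.comp (Primrec.succ.comp c) (Primrec.const [])).pair
    (primrec_eqCode.comp (primrec_boundCode.comp o) (Primrec.const topCode))
  exact Primrec.ite ((primrec_unpair_eq 3).comp c) hall
    (Primrec.ite ((primrec_unpair_eq 2).comp c) himp heq)

theorem primrec_firstChild : Primrec firstChild := by
  have u2 : Primrec fun n : ℕ => n.unpair.2 := Primrec.snd.comp Primrec.unpair
  exact Primrec.ite (primrec_unpair_eq 3) u2 (Primrec.fst.comp (Primrec.unpair.comp u2))

theorem primrec_lastChild : Primrec lastChild := by
  have u2 : Primrec fun n : ℕ => n.unpair.2 := Primrec.snd.comp Primrec.unpair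
  exact Primrec.ite (primrec_unpair_eq 3) u2 (Primrec.snd.comp (Primrec.unpair.comp u2))

theorem primrec_firstParam : Primrec firstParam := by
  have noN : Primrec fun x : ℕ × TransParam => x.2.2 := Primrec.snd.comp Primrec.snd
  have n := Primrec.fst.comp noN
  exact (Primrec.fst.comp Primrec.snd).pair ((Primrec.ite ((primrec_unpair_eq 3).comp Primrec.fst)
    (Primrec.succ.comp n) n).pair (Primrec.snd.comp noN))

theorem primrec_lastParam {α : Type} [Primcodable α] {x : α → ℕ × TransParam} {k : α → ℕ}
    (hx : Primrec x) (hk : Primrec k) : Primrec fun a => lastParam (x a) (k a) := by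
  have c : Primrec fun a => (x a).1 := Primrec.fst.comp hx
  have p : Primrec fun a => (x a).2 := Primrec.snd.comp hx
  have noN : Primrec fun a => (x a).2.2 := Primrec.snd.comp p
  have n : Primrec fun a => (x a).2.2.1 := Primrec.fst.comp noN
  have oN : Primrec fun a => (x a).2.2.2 := Primrec.snd.comp noN
  have o : Primrec fun a => (x a).2.2.2.1 := Primrec.fst.comp oN
  have N : Primrec fun a => (x a).2.2.2.2 := Primrec.snd.comp oN
  exact (Primrec.fst.comp p).pair (Primrec.ite ((primrec_unpair_eq 3).comp c)
    ((Primrec.succ.comp n).pair (N.pair (Primrec.nat_add.comp N hk)))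
    (n.pair ((Primrec.nat_add.comp o hk).pair N)))

theorem computable_transComb {α : Type} [Primcodable α] {x : α → ℕ × TransParam} {s : α → ℕ}
    {u v : α → List ℕ × ℕ} (hx : Computable x) (hs : Computable s) (hu : Computable u)
    (hv : Computable v) : Computable fun a => transComb (x a) (s a) (u a) (v a) := by
  have h : Primrec fun y : (ℕ × TransParam) × ℕ × (List ℕ × ℕ) × (List ℕ × ℕ) =>
      transComb y.1 y.2.1 y.2.2.1 y.2.2.2 :=
    primrec_transComb Primrec.fst (Primrec.fst.comp Primrec.snd)
      (Primrec.fst.comp (Primrec.snd.comp Primrec.snd))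
      (Primrec.snd.comp (Primrec.snd.comp Primrec.snd))
  have H := h.to_comp
  have args := hx.pair (hs.pair (hu.pair hv))
  have H' := H.comp args
  exact H'

theorem computable_trans : Computable₂ trans := by
  have hs : Computable fun y : (ℕ × TransParam) × (List ℕ × ℕ) × (List ℕ × ℕ) =>
      substCode y.1.2.1 (0, y.1.2.2.1) := by
    have p : Computable fun y : (ℕ × TransParam) × (List ℕ × ℕ) × (List ℕ × ℕ) => y.1.2 :=
      Computable.snd.comp Computable.fst
    exact computable_substCode.comp (Computable.fst.comp p)
      ((Computable.const 0).pair (Computable.fst.comp (Computable.snd.comp p)))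
  have hq : Primrec fun x : (ℕ × TransParam) × (List ℕ × ℕ) => lastParam x.1 x.2.1.length :=
    primrec_lastParam Primrec.fst (Primrec.list_length.comp (Primrec.fst.comp Primrec.snd))
  have hcomb := computable_transComb Computable.fst hs (Computable.fst.comp Computable.snd)
    (Computable.snd.comp Computable.snd)
  exact computable_treeRec (Computable.const _) (primrec_firstChild.comp Primrec.fst).to_comp
    (primrec_lastChild.comp Primrec.fst).to_comp primrec_firstParam.to_comp hq.to_comp hcomb

/-- The Gödel number of a free variable. -/
def freeCode (i : ℕ) : ℕ := Nat.pair 0 i + 1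

/-- The formula `∀ z_0 … z_{k-1}, z_0 = y_0 → … → z_{k-1} = y_{k-1} → ψ`, on Gödel numbers. -/
def closeCode (k ψ : ℕ) : ℕ :=
  allCode^[k] (((List.range k).map fun i => eqCode (boundCode i) (freeCode i)).foldr impCode ψ)

theorem primrec_closeCode : Primrec₂ closeCode := by
  refine primrec_iterate_allCode.comp Primrec.fst (primrec_foldr_impCode.comp
    (Primrec.list_map (Primrec.list_range.comp Primrec.fst) ?_) Primrec.snd)
  exact primrec_eqCode.comp (primrec_boundCode.comp Primrec.snd) (Primrec.succ.comp
    (Primrec₂.natPair.comp (Primrec.const 0) Primrec.snd))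

/-- The result of the algorithm, given the number of `φ` and that of a ring formula. -/
def transCode (c t : ℕ) : List ℕ × ℕ :=
  let k := (trans t (c, 0, 0, 0)).1.length
  let r := trans t (c, 0, 0, k)
  (r.1, closeCode k r.2)

theorem computable_transCode : Computable fun x : ℕ × ℕ × ℕ => transCode x.1 x.2.2 := by
  have c : Computable fun x : ℕ × ℕ × ℕ => x.1 := Computable.fst
  have t : Computable fun x : ℕ × ℕ × ℕ => x.2.2 := Computable.snd.comp Computable.snd
  have k : Computable fun x : ℕ × ℕ × ℕ => (trans x.2.2 (x.1, 0, 0, 0)).1.length :=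
    Computable.list_length.comp (Computable.fst.comp (computable_trans.comp t
      (c.pair (Computable.const (0, 0, 0)))))
  have r := computable_trans.comp t (c.pair ((Computable.const 0).pair
    ((Computable.const 0).pair k)))
  exact (Computable.fst.comp r).pair (primrec_closeCode.to_comp.comp k (Computable.snd.comp r))

end Translation

/-! ### Correctness of the translation. -/

section Correctness

attribute [local instance] idemStructure

variable {φ : Language.ring.Formula (Fin 1)} {m n : ℕ}

/-- The Gödel number of a ring formula with bound variables in scope. -/
abbrev ringFormulaCode (Θ : Language.ring.BoundedFormula (Fin m) n) : ℕ :=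
  formulaCode ringSymbCode ringRelCode Θ

/-- The Gödel number of a formula about idempotents with bound variables in scope. -/
abbrev boolFormulaCode (ψ : boolFin.BoundedFormula (Fin m) n) : ℕ :=
  formulaCode boolSymbCode boolPredCode ψ

/-- The truth of `Θ` in a ring which satisfies `A_φ` is expressed by `ψ`, applied to the sets
of atoms at which the formulas in `L` hold, which are assigned to the variables `z_o, …`. -/
def Expresses (φ : Language.ring.Formula (Fin 1)) (Θ : Language.ring.BoundedFormula (Fin m) n)
    (L : List (Language.ring.BoundedFormula (Fin m) n)) (o : ℕ) {K N : ℕ}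
    (ψ : boolFin.BoundedFormula (Fin K) N) : Prop :=
  ∀ (R : Type u) [CommRing R], SatisfiesAxioms φ R → ∀ (f : Fin m → R) (xs : Fin n → R)
    (v : Fin K → Idem R) (env : ℕ → Idem R),
    (∀ i < L.length, atomsBelow (env (o + i)) = satSet (L.getD i ⊤) f xs) →
      (ψ.Realize v (fun i => env i) ↔ Θ.Realize f xs)

/-- The translation of `Θ` is correct and uses the formulas in `L`. -/
def TranslatesTo (φ : Language.ring.Formula (Fin 1)) (Θ : Language.ring.BoundedFormula (Fin m) n)
    (L : List (Language.ring.BoundedFormula (Fin m) n)) : Prop :=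
  ∀ o N : ℕ, (trans (ringFormulaCode Θ) (ringFormulaCode φ, n, o, N)).1 = L.map ringFormulaCode ∧
    (o + L.length ≤ N → ∀ K : ℕ, ∃ ψ : boolFin.BoundedFormula (Fin K) N,
      boolFormulaCode ψ = (trans (ringFormulaCode Θ) (ringFormulaCode φ, n, o, N)).2 ∧
      Expresses.{u} φ Θ L o ψ)

theorem translatesTo_falsum :
    TranslatesTo.{u} φ (.falsum : Language.ring.BoundedFormula (Fin m) n) [] := by
  intro o N
  have e : trans (ringFormulaCode (.falsum : Language.ring.BoundedFormula (Fin m) n))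
      (ringFormulaCode φ, n, o, N) = ([], 0) := trans_zero _
  rw [e]
  exact ⟨rfl, fun _ K => ⟨.falsum, rfl, fun R _ _ f xs v env _ => Iff.rfl⟩⟩

theorem SatisfiesAxioms.eq_top_iff_realize_equal {R : Type u} [CommRing R]
    (h : SatisfiesAxioms φ R) (t₁ t₂ : Language.ring.Term (Fin m ⊕ Fin n)) (f : Fin m → R)
    (xs : Fin n → R) {x : Idem R} (hx : atomsBelow x = satSet (.equal t₁ t₂) f xs) :
    x = ⊤ ↔ (BoundedFormula.equal t₁ t₂).Realize f xs := by
  have key := h.stalkFrame.realize_equal_iff t₁ t₂ (Sum.elim f xs)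
  refine (h.eq_top_iff.trans (forall_congr' fun a => ?_)).trans key.symm
  rw [hx, Sum.comp_elim]
  rfl

theorem translatesTo_equal (t₁ t₂ : Language.ring.Term (Fin m ⊕ Fin n)) :
    TranslatesTo.{u} φ (.equal t₁ t₂) [.equal t₁ t₂] := by
  intro o N
  have e : trans (ringFormulaCode (.equal t₁ t₂ : Language.ring.BoundedFormula (Fin m) n))
      (ringFormulaCode φ, n, o, N) =
      ([ringFormulaCode (.equal t₁ t₂ : Language.ring.BoundedFormula (Fin m) n)],
        eqCode (boundCode o) topCode) := by
    rw [ringFormulaCode, formulaCode, trans_succ]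
    simp [transComb]
  rw [e]
  refine ⟨rfl, fun ho K => ⟨.equal (boundTerm K N o) topTerm, ?_, fun R _ h f xs v env henv => ?_⟩⟩
  · have ho' : o < N := ho
    rw [boolFormulaCode, formulaCode_equal, termCode_boundTerm ho', termCode_topTerm]
  · have ho' : o < N := ho
    refine Iff.trans ?_ (h.eq_top_iff_realize_equal t₁ t₂ f xs (henv 0 Nat.zero_lt_one))
    refine Iff.trans (BoundedFormula.realize_bdEqual _ _) ?_
    rw [realize_boundTerm ho', realize_topTerm, add_zero]

/-- The two lists of Boolean values occupy consecutive blocks of variables, the second starting at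
`o + L₁.length`. -/
theorem TranslatesTo.imp {Θ₁ Θ₂ : Language.ring.BoundedFormula (Fin m) n}
    {L₁ L₂ : List (Language.ring.BoundedFormula (Fin m) n)} (h₁ : TranslatesTo.{u} φ Θ₁ L₁)
    (h₂ : TranslatesTo.{u} φ Θ₂ L₂) : TranslatesTo.{u} φ (Θ₁.imp Θ₂) (L₁ ++ L₂) := by
  intro o N
  obtain ⟨e₁, H₁⟩ := h₁ o N
  obtain ⟨e₂, H₂⟩ := h₂ (o + L₁.length) N
  have e : trans (ringFormulaCode (Θ₁.imp Θ₂)) (ringFormulaCode φ, n, o, N) =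
      ((trans (ringFormulaCode Θ₁) (ringFormulaCode φ, n, o, N)).1 ++
        (trans (ringFormulaCode Θ₂) (ringFormulaCode φ, n, o + L₁.length, N)).1,
      impCode (trans (ringFormulaCode Θ₁) (ringFormulaCode φ, n, o, N)).2
        (trans (ringFormulaCode Θ₂) (ringFormulaCode φ, n, o + L₁.length, N)).2) := by
    rw [ringFormulaCode, formulaCode_imp, impCode, trans_succ]
    simp only [transComb, firstChild, lastChild, firstParam, lastParam, Nat.unpair_pair,
      Nat.reduceEqDiff, if_false, if_true, e₁, List.length_map]
  rw [e]
  refine ⟨by rw [e₁, e₂, List.map_append], fun ho K => ?_⟩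
  rw [List.length_append] at ho
  obtain ⟨ψ₁, c₁, E₁⟩ := H₁ (by omega) K
  obtain ⟨ψ₂, c₂, E₂⟩ := H₂ (by omega) K
  refine ⟨ψ₁.imp ψ₂, ?_, fun R _ h f xs v env henv => ?_⟩
  · rw [boolFormulaCode, formulaCode_imp]
    exact congrArg₂ impCode c₁ c₂
  · refine imp_congr (E₁ R h f xs v env fun i hi => ?_) (E₂ R h f xs v env fun i hi => ?_)
    · rw [henv i (by rw [List.length_append]; omega), List.getD_append _ _ _ _ hi]
    · rw [add_assoc, henv _ (by rw [List.length_append]; omega),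
        List.getD_append_right _ _ _ _ (by omega), Nat.add_sub_cancel_left]

/-- The formula `φ(z_n)`. -/
def lastFormula (m n : ℕ) (φ : Language.ring.Formula (Fin 1)) :
    Language.ring.BoundedFormula (Fin m) (n + 1) :=
  BoundedFormula.relabel (n := n + 1) (k := 0) (lastLabel m n) φ

/-- The formulas whose Boolean values are needed in order to translate a quantifier, given those
needed for its scope. -/
def quantifierFormulas (φ : Language.ring.Formula (Fin 1))
    (L : List (Language.ring.BoundedFormula (Fin m) (n + 1))) :
    List (Language.ring.BoundedFormula (Fin m) n) :=
  (signFormulas L).map BoundedFormula.ex ++ (signFormulas L).map fun s =>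
    BoundedFormula.ex (lastFormula m n φ ⊓ s)

theorem length_quantifierFormulas (L : List (Language.ring.BoundedFormula (Fin m) (n + 1))) :
    (quantifierFormulas φ L).length = 2 ^ L.length + 2 ^ L.length := by
  simp [quantifierFormulas, length_signFormulas]

theorem map_quantifierFormulas (L : List (Language.ring.BoundedFormula (Fin m) (n + 1))) :
    (quantifierFormulas φ L).map ringFormulaCode =
      quantifierCodes (substCode (ringFormulaCode φ) (0, n)) (L.map ringFormulaCode) := by
  have e : signs andCode notCode (notCode 0) (L.map ringFormulaCode) =
      (signFormulas L).map ringFormulaCode :=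
    (map_signs (g := ringFormulaCode) (and := (· ⊓ ·)) (neg := BoundedFormula.not) (top := ⊤)
      (fun _ _ => rfl) (fun _ => rfl) rfl L).symm
  have e' : substCode (ringFormulaCode φ) (0, n) = ringFormulaCode (lastFormula m n φ) :=
    substCode_formula φ
  rw [quantifierCodes, e, e', quantifierFormulas, List.map_append, List.map_map, List.map_map,
    List.map_map, List.map_map]
  rfl

theorem mem_satSet_ex {R : Type u} [CommRing R]
    (s : Language.ring.BoundedFormula (Fin m) (n + 1)) (f : Fin m → R) (xs : Fin n → R)
    (a : Atoms R) : a ∈ satSet s.ex f xs ↔ ∃ w : Stalk a.1,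
      s.Realize (algebraMap R (Stalk a.1) ∘ f) (Fin.snoc (algebraMap R (Stalk a.1) ∘ xs) w) :=
  BoundedFormula.realize_ex

theorem mem_satSet_ex_inf {R : Type u} [CommRing R]
    (s : Language.ring.BoundedFormula (Fin m) (n + 1)) (f : Fin m → R) (xs : Fin n → R)
    (a : Atoms R) :
    a ∈ satSet (BoundedFormula.ex (lastFormula m n φ ⊓ s)) f xs ↔
      ∃ w : Stalk a.1, φ.Realize (fun _ => w) ∧
        s.Realize (algebraMap R (Stalk a.1) ∘ f) (Fin.snoc (algebraMap R (Stalk a.1) ∘ xs) w) := by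
  refine (mem_satSet_ex _ f xs a).trans (exists_congr fun w => ?_)
  exact BoundedFormula.realize_inf.trans (and_congr_left fun _ => realize_relabel_last _ _ w φ)

/-- The scope needs `L.length` fresh variables from `z_N` on, a number known only after translating
it. As the list of formulas does not depend on `o` and `N`, a first recursive call with the old
values yields the length (`e₁`), and a second one the formula (`e₂`). -/
theorem TranslatesTo.all {Θ : Language.ring.BoundedFormula (Fin m) (n + 1)}
    {L : List (Language.ring.BoundedFormula (Fin m) (n + 1))} (hΘ : TranslatesTo.{u} φ Θ L) :
    TranslatesTo.{u} φ Θ.all (quantifierFormulas φ L) := by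
  intro o N
  obtain ⟨e₁, -⟩ := hΘ o N
  obtain ⟨e₂, H⟩ := hΘ N (N + L.length)
  have e : trans (ringFormulaCode Θ.all) (ringFormulaCode φ, n, o, N) =
      ((quantifierFormulas φ L).map ringFormulaCode, blockCode o N L.length
        (trans (ringFormulaCode Θ) (ringFormulaCode φ, n + 1, N, N + L.length)).2) := by
    rw [ringFormulaCode, formulaCode_all, allCode, trans_succ, map_quantifierFormulas]
    simp only [transComb, firstChild, lastChild, firstParam, lastParam, Nat.unpair_pair, if_true,
      e₁, e₂, List.length_map]
  rw [e]
  refine ⟨rfl, fun ho K => ?_⟩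
  rw [length_quantifierFormulas] at ho
  obtain ⟨ψ, c, E⟩ := H le_rfl K
  obtain ⟨ψ', c', E'⟩ := exists_block.{u} ho ψ
  refine ⟨ψ', by rw [boolFormulaCode, c', ← c], fun R _ h f xs v env henv => ?_⟩
  rw [length_quantifierFormulas] at henv
  refine (E' R v env).trans ?_
  refine (h.forall_block_iff L f xs rfl env (fun j => env (o + j))
    (fun j => env (o + 2 ^ L.length + j)) (fun j hj a => ?_) (fun j hj a => ?_)
    (fun env' => ψ.Realize v fun i => env' i) (fun g => Θ.Realize f (Fin.snoc xs g))
    fun env' g he => E R h f (Fin.snoc xs g) v env' he).trans BoundedFormula.realize_all.symm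
  · have hj' : j < (signFormulas L).length := by rwa [length_signFormulas]
    rw [henv j (by omega), quantifierFormulas, List.getD_append _ _ _ _ (by rwa [List.length_map]),
      getD_map_of_lt _ _ hj' ⊤]
    exact mem_satSet_ex _ f xs a
  · have hj' : j < (signFormulas L).length := by rwa [length_signFormulas]
    have hl : (List.map BoundedFormula.ex (signFormulas L)).length = 2 ^ L.length := by
      rw [List.length_map, length_signFormulas]
    rw [add_assoc, henv _ (by omega), quantifierFormulas,
      List.getD_append_right _ _ _ _ (by omega), hl, Nat.add_sub_cancel_left,
      getD_map_of_lt _ _ hj' ⊤]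
    exact mem_satSet_ex_inf _ f xs a

theorem exists_translatesTo (φ : Language.ring.Formula (Fin 1))
    (Θ : Language.ring.BoundedFormula (Fin m) n) : ∃ L, TranslatesTo.{u} φ Θ L := by
  induction Θ with
  | falsum => exact ⟨_, translatesTo_falsum⟩
  | equal t₁ t₂ => exact ⟨_, translatesTo_equal t₁ t₂⟩
  | rel s => exact s.elim
  | imp Θ₁ Θ₂ ih₁ ih₂ =>
    obtain ⟨L₁, h₁⟩ := ih₁
    obtain ⟨L₂, h₂⟩ := ih₂
    exact ⟨_, h₁.imp h₂⟩
  | all Θ ih =>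
    obtain ⟨L, h⟩ := ih
    exact ⟨_, h.all⟩

/-- The translation reads its parameters from bound variables; the premises `z_i = y_i` tie them to
the free variables without rewriting the formula. -/
theorem exists_close {k : ℕ} (ψ : boolFin.BoundedFormula (Fin k) (0 + k)) :
    ∃ ψ' : boolFin.Formula (Fin k), boolFormulaCode ψ' = closeCode k (boolFormulaCode ψ) ∧
      ∀ (R : Type u) [CommRing R] (v : Fin k → Idem R) (env : ℕ → Idem R),
        (∀ i : Fin k, env i = v i) → (ψ'.Realize v ↔ ψ.Realize v fun i => env i) := by
  obtain ⟨ψ', c, E⟩ := exists_iterate_all.{u} (n := 0) k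
    (((List.finRange k).map fun i : Fin k => BoundedFormula.equal (boundTerm k (0 + k) i)
      (.var (.inl i))).foldr BoundedFormula.imp ψ)
  refine ⟨ψ', ?_, fun R _ v env henv => ?_⟩
  · rw [boolFormulaCode, c, formulaCode_foldr_imp, List.map_map, closeCode,
      ← List.map_coe_finRange_eq_range, List.map_map]
    congr 3
    funext i
    rw [Function.comp, Function.comp, formulaCode_equal, termCode_boundTerm (by omega)]
    rfl
  · have h₀ : Formula.Realize ψ' v ↔ BoundedFormula.Realize ψ' v fun i : Fin 0 => env i :=
      iff_of_eq (congrArg (BoundedFormula.Realize ψ' v) (Subsingleton.elim _ _))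
    have h₁ : ∀ (env' : ℕ → Idem R) (i : Fin k),
        (BoundedFormula.equal (boundTerm k (0 + k) i) (.var (.inl i))).Realize v
          (fun i => env' i) ↔ env' i = v i := by
      intro env' i
      refine (BoundedFormula.realize_bdEqual _ _).trans ?_
      rw [realize_boundTerm (by omega)]
      rfl
    refine h₀.trans ((E R v env).trans ?_)
    simp only [BoundedFormula.realize_foldr_imp, List.mem_map, List.mem_finRange, true_and,
      forall_exists_index, forall_apply_eq_imp_iff, h₁]
    constructor
    · exact fun H => H env (fun j hj => rfl) henv
    · intro H env' _ he
      have e : (fun i : Fin (0 + k) => env' i) = fun i : Fin (0 + k) => env i := by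
        funext i
        have hi : (i : ℕ) < k := by omega
        exact (he ⟨i, hi⟩).trans (henv ⟨i, hi⟩).symm
      rw [e]
      exact H

/-- Again the first run, with `N = 0`, serves only to find the number `k` of parameters; the second
run reserves `z_0, …, z_{k-1}` for them. -/
theorem exists_transCode (φ : Language.ring.Formula (Fin 1)) (Θ : Language.ring.Formula (Fin m)) :
    ∃ (k : ℕ) (Θs : Fin k → Language.ring.Formula (Fin m)) (ψ : boolFin.Formula (Fin k)),
      transCode (ringCode φ) (ringCode Θ) =
        (List.ofFn fun i => ringCode (Θs i), boolCode ψ) ∧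
      ∀ (R : Type u) [CommRing R], SatisfiesAxioms φ R → ∀ f : Fin m → R,
        RingSat Θ f ↔ BoolSat (finSupp R) ψ (fun i => boolVal (Θs i) f) := by
  obtain ⟨L, hL⟩ := exists_translatesTo.{u} φ (n := 0) Θ
  obtain ⟨e₀, -⟩ := hL 0 0
  obtain ⟨e, H⟩ := hL 0 (0 + L.length)
  obtain ⟨ψ, c, E⟩ := H le_rfl L.length
  rw [zero_add] at e
  obtain ⟨ψ', c', E'⟩ := exists_close.{u} ψ
  refine ⟨L.length, fun i => L[i], ψ', ?_, fun R _ h f => ?_⟩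
  · have hk : (trans (ringCode Θ) (ringCode φ, 0, 0, 0)).1.length = L.length := by
      rw [ringCode_eq, ringCode_eq, e₀, List.length_map]
    rw [transCode, hk]
    refine Prod.ext (e.trans ?_) ?_
    · exact (List.ofFn_getElem_eq_map L ringFormulaCode).symm
    · exact (congrArg (closeCode L.length) (by rw [c, zero_add]; rfl)).trans c'.symm
  · let env : ℕ → Idem R := fun i => boolVal (α := Fin m) (L.getD i ⊤) f
    have hv : ∀ i : Fin L.length, env i = boolVal (α := Fin m) L[i] f := fun i =>
      congrArg (fun θ : Language.ring.Formula (Fin m) => boolVal θ f)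
        (List.getD_eq_getElem L ⊤ i.2)
    have key := E R h f default (fun i => boolVal (α := Fin m) L[i] f) env fun i _ => by
      rw [zero_add, h.atomsBelow_boolVal]
      ext a
      exact iff_of_eq (congrArg ((L.getD i ⊤).Realize _) (Subsingleton.elim _ _))
    exact key.symm.trans (E' R _ env hv).symm

end Correctness

end RingFV

/-- Part 1: there is an algorithm which, given the Gödel numbers of `φ` and of a ring formula `Θ` in
`m` free variables, outputs those of ring formulas `Θ_1, …, Θ_k` in the same free variables and
of a formula `ψ` in `k` free variables of the enriched language of Boolean algebras, such that in
every ring `R` satisfying `A_φ`, `Θ(f)` holds if and only if `ψ` holds of the Boolean values of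
the `Θ_i(f)`. Part 2: such an `R` is elementarily equivalent to the restricted product, with
respect to `φ`, of its stalks at atoms (which is a subring of the full product). -/
theorem mainTheorem4 :
    (∃ F : ℕ × ℕ × ℕ → List ℕ × ℕ, Computable F ∧
      ∀ (φ : FirstOrder.Language.ring.Formula (Fin 1)) (m : ℕ)
        (Θ : FirstOrder.Language.ring.Formula (Fin m)),
        ∃ (k : ℕ) (Θs : Fin k → FirstOrder.Language.ring.Formula (Fin m))
          (ψ : RingFV.boolFin.Formula (Fin k)),
          F (RingFV.ringCode φ, m, RingFV.ringCode Θ) =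
            (List.ofFn fun i => RingFV.ringCode (Θs i), RingFV.boolCode ψ) ∧
          ∀ (R : Type u) [CommRing R], RingFV.SatisfiesAxioms φ R →
            ∀ f : Fin m → R,
              RingFV.RingSat Θ f ↔
                RingFV.BoolSat (RingFV.finSupp R) ψ (fun i => RingFV.boolVal (Θs i) f)) ∧
    (∀ (φ : FirstOrder.Language.ring.Formula (Fin 1)) (R : Type u) [CommRing R],
      RingFV.SatisfiesAxioms φ R →
        ∃ P : Subring (∀ e : RingFV.Atoms R, RingFV.Stalk e.1),
          (∀ a, a ∈ P ↔ {e | ¬ RingFV.RingSat φ (fun _ => a e)}.Finite) ∧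
          RingFV.RingElemEquiv R P) := by
  refine ⟨⟨_, RingFV.computable_transCode, fun φ m Θ => ?_⟩, fun φ R _ h => ?_⟩
  · exact RingFV.exists_transCode φ Θ
  · exact h.exists_restrictedProduct
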